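/- Let $N\ge 1$ be an integer and $s\in(0,1)$ with $2s<N$. Let $\mathbb S^N\subset\mathbb R^{N+1}$ be the unit sphere with its round metric $g$ and volume element $dV_g$, let $|\cdot|$ denote the Euclidean norm, and set $$c_{N,s}:=4^s\pi^{-\frac N2}\frac{\Gamma(\frac N2+s)}{\Gamma(2-s)}s(1-s),\qquad A_{N,s}:=\frac{\Gamma(\frac N2+s)}{\Gamma(\frac N2-s)},\qquad \psi_s(x):=\left(\frac{2}{1+|x|^2}\right)^{\frac{N-2s}{2}}\quad(x\in\mathbb R^N).$$ For $u\in C^\infty(\mathbb S^N)$ real-valued and $z\in\mathbb S^N$ let $$\mathscr P^s_g u(z):=c_{N,s}\ \mathrm{p.v.}\!\int_{\mathbb S^N}\frac{u(z)-u(\zeta)}{|z-\zeta|^{N+2s}}\,dV_g(\zeta)+A_{N,s}\,u(z),$$ and for $w:\mathbb R^N\to\mathbb R$ let $$(-\Delta)^s w(x):=c_{N,s}\ \mathrm{p.v.}\!\int_{\mathbb R^N}\frac{w(x)-w(y)}{|x-y|^{N+2s}}\,dy,$$ where $\mathrm{p.v.}$ denotes the limit, as $\varepsilon\downarrow0$,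 of the integrals over $\{|z-\zeta|>\varepsilon\}$, respectively $\{|x-y|>\varepsilon\}$. Let $\sigma:\mathbb S^N\setminus\{-e_{N+1}\}\to\mathbb R^N$, $\sigma(z)=\frac{z'}{1+z_{N+1}}$ for $z=(z',z_{N+1})$, be the stereographic projection, with inverse $\sigma^{-1}(x)=\left(\frac{2x}{1+|x|^2},\frac{1-|x|^2}{1+|x|^2}\right)$. Then for every $u\in C^\infty(\mathbb S^N)$, with $v:=u\circ\sigma^{-1}$, every $z\in\mathbb S^N\setminus\{-e_{N+1}\}$ and $x=\sigma(z)$, the principal values defining $\mathscr P^s_g u(z)$ and $(-\Delta)^s(\psi_s v)(x)$ exist (the truncated integrals converge absolutely and have finite limits), and $$\mathscr P^s_g u(z)=\psi_s(x)^{-\frac{N+2s}{N-2s}}\,(-\Delta)^s(\psi_s v)(x).$$ -/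

import Mathlib

open MeasureTheory Filter Topology
open scoped Manifold ContDiff

noncomputable section

namespace ConformalSphere

/-- `ℝ^N` with its Euclidean norm. -/
abbrev Euc (N : ℕ) : Type := EuclideanSpace ℝ (Fin N)

/-- The unit sphere `S^N` in `ℝ^(N+1)`. Its metric is the chordal distance of `ℝ^(N+1)`. -/
abbrev Sph (N : ℕ) : Type := Metric.sphere (0 : Euc (N + 1)) 1

/-- The volume element `V_g` of the round metric on `S^N`: the surface measure. -/
abbrev sphVol (N : ℕ) : Measure (Sph N) := (volume : Measure (Euc (N + 1))).toSphere

/-- The south pole `-e_{N+1}`. -/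
def southPole (N : ℕ) : Sph N :=
  ⟨-EuclideanSpace.single (Fin.last N) (1 : ℝ), by simp⟩

/-- The stereographic projection `σ(z) = z' / (1 + z_{N+1})` (used away from the south pole). -/
def stereo {N : ℕ} (z : Sph N) : Euc N :=
  WithLp.toLp 2 fun i : Fin N =>
    (z : Euc (N + 1)) i.castSucc / (1 + (z : Euc (N + 1)) (Fin.last N))

/-- The vector `(2x / (1 + |x|²), (1 - |x|²) / (1 + |x|²))` of `ℝ^(N+1)`. -/
def stereoInvVec {N : ℕ} (x : Euc N) : Euc (N + 1) :=
  WithLp.toLp 2 (Fin.snoc (α := fun _ => ℝ) (fun i : Fin N => 2 * x i / (1 + ‖x‖ ^ 2))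
    ((1 - ‖x‖ ^ 2) / (1 + ‖x‖ ^ 2)))

theorem stereoInvVec_mem {N : ℕ} (x : Euc N) :
    stereoInvVec x ∈ Metric.sphere (0 : Euc (N + 1)) 1 := by
  have hpos : (0 : ℝ) < 1 + ‖x‖ ^ 2 := by positivity
  have hx : ‖x‖ ^ 2 = ∑ i, x i ^ 2 := EuclideanSpace.real_norm_sq_eq x
  have hsq : ‖stereoInvVec x‖ ^ 2 = 1 := by
    rw [EuclideanSpace.real_norm_sq_eq, Fin.sum_univ_castSucc]
    simp only [stereoInvVec, Fin.snoc_castSucc, Fin.snoc_last, div_pow, mul_pow]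
    rw [← Finset.sum_div, ← Finset.mul_sum, ← hx]
    field_simp
    ring
  have h1 : ‖stereoInvVec x‖ = 1 := by
    rw [← Real.sqrt_sq (norm_nonneg (stereoInvVec x)), hsq, Real.sqrt_one]
  simpa using h1

/-- The inverse stereographic projection `σ⁻¹ : ℝ^N → S^N`. -/
def stereoInv {N : ℕ} (x : Euc N) : Sph N := ⟨stereoInvVec x, stereoInvVec_mem x⟩

/-- Integral of `f` over the complement of the closed ball of radius `ε` around `a`. -/
def truncInt {α : Type*} [MetricSpace α] [MeasurableSpace α] (μ : Measure α) (a : α)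
    (f : α → ℝ) (ε : ℝ) : ℝ :=
  ∫ y in {y | ε < dist a y}, f y ∂μ

/-- The principal value `p.v. ∫ f dμ` at `a` exists: every truncated integral converges
absolutely, and the truncated integrals have a finite limit as `ε ↓ 0`. -/
def PVExists {α : Type*} [MetricSpace α] [MeasurableSpace α] (μ : Measure α) (a : α)
    (f : α → ℝ) : Prop :=
  (∀ ε : ℝ, 0 < ε → IntegrableOn f {y | ε < dist a y} μ) ∧
    ∃ L : ℝ, Tendsto (truncInt μ a f) (𝓝[>] 0) (𝓝 L)

/-- The principal value `p.v. ∫ f dμ` at `a`. -/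
def pv {α : Type*} [MetricSpace α] [MeasurableSpace α] (μ : Measure α) (a : α)
    (f : α → ℝ) : ℝ :=
  limUnder (𝓝[>] (0 : ℝ)) (truncInt μ a f)

/-- The constant `c_{N,s}`. -/
def cConst (N : ℕ) (s : ℝ) : ℝ :=
  4 ^ s * Real.pi ^ (-((N : ℝ) / 2)) * (Real.Gamma ((N : ℝ) / 2 + s) / Real.Gamma (2 - s)) *
    s * (1 - s)

/-- The constant `A_{N,s}`. -/
def AConst (N : ℕ) (s : ℝ) : ℝ :=
  Real.Gamma ((N : ℝ) / 2 + s) / Real.Gamma ((N : ℝ) / 2 - s)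

/-- The integrand `y ↦ (w(x) - w(y)) / |x - y|^(N+2s)` on `ℝ^N`. -/
def eucIntegrand {N : ℕ} (s : ℝ) (w : Euc N → ℝ) (x y : Euc N) : ℝ :=
  (w x - w y) / ‖x - y‖ ^ ((N : ℝ) + 2 * s)

/-- The fractional Laplacian `(-Δ)^s w (x)` on `ℝ^N`. -/
def fracLap {N : ℕ} (s : ℝ) (w : Euc N → ℝ) (x : Euc N) : ℝ :=
  cConst N s * pv volume x (eucIntegrand s w x)

/-- The integrand `ζ ↦ (u(z) - u(ζ)) / |z - ζ|^(N+2s)` on `S^N`, `|·|` being the norm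
of `ℝ^(N+1)`. -/
def sphIntegrand {N : ℕ} (s : ℝ) (u : Sph N → ℝ) (z ζ : Sph N) : ℝ :=
  (u z - u ζ) / ‖(z : Euc (N + 1)) - (ζ : Euc (N + 1))‖ ^ ((N : ℝ) + 2 * s)

/-- The conformal fractional Laplacian on `S^N`, as a singular integral. -/
def confFracLap {N : ℕ} (s : ℝ) (u : Sph N → ℝ) (z : Sph N) : ℝ :=
  cConst N s * pv (sphVol N) z (sphIntegrand s u z) + AConst N s * u z

/-- The conformal factor `ψ_s(x) = (2 / (1 + |x|²))^((N-2s)/2)`. -/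
def psi {N : ℕ} (s : ℝ) (x : Euc N) : ℝ :=
  (2 / (1 + ‖x‖ ^ 2)) ^ (((N : ℝ) - 2 * s) / 2)

end ConformalSphere

end

/-! Write J(y) = 2/(1+|y|²), a = (N-2s)/2 and w = ψ_s v, so that ψ_s = J^a. Stereographic projection
gives |z-ζ|² = J(x)J(y)|x-y|² (`norm_stereoInv_sub_sq`) and dV_g = J(y)^N dy (`sphVol_eq_map`). The
spherical kernel therefore becomes J(x)^(-(N+2s)/2) ψ_s(y)(v(x)-v(y))/|x-y|^(N+2s). Since
ψ_s(y)(v(x)-v(y)) = (w(x)-w(y)) - v(x)(ψ_s(x)-ψ_s(y)), the singular integral of u is a multiple of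
(-Δ)^s w(x) - v(x)(-Δ)^s ψ_s(x). The bubble equation (-Δ)^s ψ_s = A_{N,s} J^((N+2s)/2) turns the
last term into exactly -A_{N,s}u(z), which the zero-order term of the operator cancels.

Two points need work, and the inversion y = x + η/|η|² settles both. First, the sphere truncates by
chordal balls and ℝ^N by Euclidean ones. In the variable η these become balls of radius R about
-(J(x)/2)x and about 0, up to the point 0. They differ inside a shell of fixed width and volume
O(R^(N-1)), where the transformed integrand is O(R^(-(N-2s)-1)); the discrepancy is O(R^(2s-2)) and
vanishes as s < 1 (`tendsto_shell`, `tendsto_chordal_trunc`).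

Second, the inversion turns the integral for ψ_s into that of |η|^(-2a) - (|η+kx|²+k²)^(-a) with k =
J(x)/2. The shift by kx is again a shell effect (`tendsto_profile_shift`), and the centred integral
is computed by Tonelli and Gamma integrals (`lintegral_norm_rpow_sub`). -/

namespace ConformalSphere

/-! ### Stereographic coordinates and the chordal distance -/

/-- The conformal factor `2 / (1 + |y|²)` of the inverse stereographic projection. -/
noncomputable def confFactor {N : ℕ} (y : Euc N) : ℝ := 2 / (1 + ‖y‖ ^ 2)

theorem one_add_norm_sq_pos {N : ℕ} (y : Euc N) : 0 < 1 + ‖y‖ ^ 2 := by positivity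

theorem confFactor_pos {N : ℕ} (y : Euc N) : 0 < confFactor y := by
  unfold confFactor; positivity

theorem confFactor_le_two {N : ℕ} (y : Euc N) : confFactor y ≤ 2 := by
  unfold confFactor
  rw [div_le_iff₀ (by positivity)]
  nlinarith [sq_nonneg ‖y‖]

theorem continuous_confFactor (N : ℕ) : Continuous (confFactor (N := N)) := by
  unfold confFactor
  exact continuous_const.div (by fun_prop) fun y => (one_add_norm_sq_pos y).ne'

theorem psi_eq_confFactor {N : ℕ} (s : ℝ) (y : Euc N) :
    psi s y = confFactor y ^ (((N : ℝ) - 2 * s) / 2) := rfl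

theorem psi_pos {N : ℕ} (s : ℝ) (y : Euc N) : 0 < psi s y :=
  Real.rpow_pos_of_pos (confFactor_pos y) _

theorem coe_stereoInv_castSucc {N : ℕ} (y : Euc N) (i : Fin N) :
    (stereoInv y : Euc (N + 1)) i.castSucc = 2 * y i / (1 + ‖y‖ ^ 2) := by
  simp [stereoInv, stereoInvVec]

theorem coe_stereoInv_last {N : ℕ} (y : Euc N) :
    (stereoInv y : Euc (N + 1)) (Fin.last N) = (1 - ‖y‖ ^ 2) / (1 + ‖y‖ ^ 2) := by
  simp [stereoInv, stereoInvVec]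

theorem sphere_sum_sq {N : ℕ} (z : Sph N) :
    ∑ i : Fin N, (z : Euc (N + 1)) i.castSucc ^ 2 + (z : Euc (N + 1)) (Fin.last N) ^ 2 = 1 := by
  rw [← Fin.sum_univ_castSucc (fun i => (z : Euc (N + 1)) i ^ 2), ← EuclideanSpace.real_norm_sq_eq,
    norm_eq_of_mem_sphere, one_pow]

theorem one_add_last_pos {N : ℕ} {z : Sph N} (hz : z ≠ southPole N) :
    0 < 1 + (z : Euc (N + 1)) (Fin.last N) := by
  have h1 := sphere_sum_sq z
  have h2 : 0 ≤ ∑ i : Fin N, (z : Euc (N + 1)) i.castSucc ^ 2 :=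
    Finset.sum_nonneg fun i _ => sq_nonneg _
  by_contra! h
  have h3 : (z : Euc (N + 1)) (Fin.last N) = -1 := by nlinarith
  have h4 : ∑ i : Fin N, (z : Euc (N + 1)) i.castSucc ^ 2 = 0 := by rw [h3] at h1; linarith
  rw [Finset.sum_eq_zero_iff_of_nonneg fun i _ => sq_nonneg _] at h4
  apply hz
  ext i
  refine Fin.lastCases ?_ (fun j => ?_) i
  · simp [southPole, h3]
  · have := h4 j (Finset.mem_univ _)
    simp only [southPole, PiLp.neg_apply, PiLp.single_apply]
    rw [if_neg (Fin.castSucc_lt_last j).ne, neg_zero]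
    exact pow_eq_zero_iff (two_ne_zero) |>.1 this

theorem stereoInv_stereo {N : ℕ} {z : Sph N} (hz : z ≠ southPole N) :
    stereoInv (stereo z) = z := by
  have h0 := one_add_last_pos hz
  have h1 := sphere_sum_sq z
  set t := (z : Euc (N + 1)) (Fin.last N) with ht
  have h2 : ‖stereo z‖ ^ 2 = (1 - t) / (1 + t) := by
    rw [EuclideanSpace.real_norm_sq_eq]
    simp only [stereo, div_pow]
    rw [← Finset.sum_div, div_eq_div_iff (by positivity) h0.ne', ← ht]
    have : ∑ i : Fin N, (z : Euc (N + 1)) i.castSucc ^ 2 = 1 - t ^ 2 := by linarith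
    rw [this]; ring
  have h3 : 1 + ‖stereo z‖ ^ 2 = 2 / (1 + t) := by rw [h2]; field_simp; ring
  ext i
  refine Fin.lastCases ?_ (fun j => ?_) i
  · rw [coe_stereoInv_last, h3, h2, ← ht]; field_simp; ring
  · rw [coe_stereoInv_castSucc, h3]
    simp only [stereo, ← ht]
    field_simp

/-- The chordal distance in stereographic coordinates. -/
theorem norm_stereoInv_sub_sq {N : ℕ} (x y : Euc N) :
    ‖(stereoInv x : Euc (N + 1)) - stereoInv y‖ ^ 2 =
      confFactor x * confFactor y * ‖x - y‖ ^ 2 := by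
  have hx := one_add_norm_sq_pos x
  have hy := one_add_norm_sq_pos y
  have hin : inner ℝ (stereoInv x : Euc (N + 1)) (stereoInv y : Euc (N + 1)) =
      (4 * inner ℝ x y + (1 - ‖x‖ ^ 2) * (1 - ‖y‖ ^ 2)) / ((1 + ‖x‖ ^ 2) * (1 + ‖y‖ ^ 2)) := by
    simp only [PiLp.inner_apply]
    rw [Fin.sum_univ_castSucc]
    simp only [coe_stereoInv_castSucc, coe_stereoInv_last, RCLike.inner_apply, conj_trivial]
    rw [add_div, Finset.mul_sum, Finset.sum_div]
    congr 1
    · refine Finset.sum_congr rfl fun i _ => ?_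
      field_simp
      ring
    · field_simp
  rw [norm_sub_sq_real, norm_sub_sq_real, hin, norm_eq_of_mem_sphere, norm_eq_of_mem_sphere]
  unfold confFactor
  field_simp
  ring

theorem norm_stereoInv_sub {N : ℕ} (x y : Euc N) :
    ‖(stereoInv x : Euc (N + 1)) - stereoInv y‖ =
      (confFactor x * confFactor y) ^ (1 / 2 : ℝ) * ‖x - y‖ := by
  have hx := confFactor_pos x
  have hy := confFactor_pos y
  rw [← Real.sqrt_eq_rpow, ← Real.sqrt_sq (norm_nonneg (x - y)),
    ← Real.sqrt_mul (by positivity), ← norm_stereoInv_sub_sq, Real.sqrt_sq (norm_nonneg _)]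

theorem stereoInv_injective (N : ℕ) : Function.Injective (stereoInv (N := N)) := by
  intro x y h
  have h1 := norm_stereoInv_sub_sq x y
  rw [h, sub_self, norm_zero] at h1
  have h2 := mul_pos (confFactor_pos x) (confFactor_pos y)
  have h3 : ‖x - y‖ ^ 2 = 0 := by
    rcases mul_eq_zero.1 (h1.symm.trans (by norm_num)) with h | h
    · exact absurd h h2.ne'
    · exact h
  exact sub_eq_zero.1 (norm_eq_zero.1 (pow_eq_zero_iff two_ne_zero |>.1 h3))

theorem contDiff_stereoInvVec (N : ℕ) : ContDiff ℝ ∞ (stereoInvVec (N := N)) := by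
  rw [contDiff_euclidean]
  intro i
  have hd : ContDiff ℝ ∞ fun y : Euc N => 1 + ‖y‖ ^ 2 := contDiff_const.add (contDiff_norm_sq ℝ)
  refine Fin.lastCases ?_ (fun j => ?_) i
  · simp only [stereoInvVec, Fin.snoc_last]
    exact (contDiff_const.sub (contDiff_norm_sq ℝ)).div hd fun y => (one_add_norm_sq_pos y).ne'
  · simp only [stereoInvVec, Fin.snoc_castSucc]
    exact (contDiff_const.mul (contDiff_euclidean.1 contDiff_id j)).div hd
      fun y => (one_add_norm_sq_pos y).ne'

theorem continuous_stereoInv (N : ℕ) : Continuous (stereoInv (N := N)) :=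
  (contDiff_stereoInvVec N).continuous.subtype_mk _

theorem measurableEmbedding_stereoInv (N : ℕ) : MeasurableEmbedding (stereoInv (N := N)) :=
  (continuous_stereoInv N).measurableEmbedding (stereoInv_injective N)

theorem contDiff_comp_stereoInv {N : ℕ} {u : Sph N → ℝ} (hu : ContMDiff (𝓡 N) 𝓘(ℝ, ℝ) ∞ u) :
    ContDiff ℝ ∞ (u ∘ stereoInv) := by
  have := Fact.mk (@finrank_euclideanSpace_fin ℝ _ (N + 1))
  have h1 : ContMDiff 𝓘(ℝ, Euc N) (𝓡 N) ∞ (stereoInv (N := N)) :=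
    (contDiff_stereoInvVec N).contMDiff.codRestrict_sphere stereoInvVec_mem
  exact contMDiff_iff_contDiff.1 (hu.comp h1)

theorem contDiff_psi (N : ℕ) (s : ℝ) : ContDiff ℝ ∞ (psi (N := N) s) := by
  have hd : ContDiff ℝ ∞ fun y : Euc N => 1 + ‖y‖ ^ 2 := contDiff_const.add (contDiff_norm_sq ℝ)
  exact (contDiff_const.div hd fun y => (one_add_norm_sq_pos y).ne').rpow_const_of_ne
    fun y => (confFactor_pos y).ne'

theorem psi_le {N : ℕ} {s : ℝ} (hs : 2 * s < N) (y : Euc N) :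
    psi s y ≤ 2 ^ (((N : ℝ) - 2 * s) / 2) :=
  Real.rpow_le_rpow (confFactor_pos y).le (confFactor_le_two y) (by linarith)

/-! ### Gamma integrals and the bubble constant -/

theorem lintegral_rpow_mul_exp_neg {a r : ℝ} (ha : 0 < a) (hr : 0 < r) :
    ∫⁻ t in Set.Ioi (0 : ℝ), ENNReal.ofReal (t ^ (a - 1) * Real.exp (-(r * t))) =
      ENNReal.ofReal (r ^ (-a) * Real.Gamma a) := by
  have hval := Real.integral_rpow_mul_exp_neg_mul_Ioi ha hr
  have hpos : 0 < (1 / r) ^ a * Real.Gamma a :=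
    mul_pos (Real.rpow_pos_of_pos (by positivity) _) (Real.Gamma_pos_of_pos ha)
  -- A non-integrable function has Bochner integral 0, so a positive value forces integrability.
  have hint := Integrable.of_integral_ne_zero (hval.trans_ne hpos.ne')
  rw [← ofReal_integral_eq_lintegral_ofReal hint, hval, one_div, Real.inv_rpow hr.le,
    Real.rpow_neg hr.le]
  filter_upwards [self_mem_ae_restrict measurableSet_Ioi] with t ht
  exact mul_nonneg (Real.rpow_nonneg (le_of_lt ht) _) (Real.exp_pos _).le

theorem lintegral_exp_neg_mul_norm_sq (N : ℕ) {b : ℝ} (hb : 0 < b) :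
    ∫⁻ x : Euc N, ENNReal.ofReal (Real.exp (-b * ‖x‖ ^ 2)) =
      ENNReal.ofReal ((Real.pi / b) ^ ((N : ℝ) / 2)) := by
  have hval := GaussianFourier.integral_rexp_neg_mul_sq_norm (V := Euc N) hb
  rw [finrank_euclideanSpace_fin] at hval
  have hpos : 0 < (Real.pi / b) ^ ((N : ℝ) / 2) := Real.rpow_pos_of_pos (by positivity) _
  have hint := Integrable.of_integral_ne_zero (hval.trans_ne hpos.ne')
  rw [← ofReal_integral_eq_lintegral_ofReal hint, hval]
  exact ae_of_all _ fun x => (Real.exp_pos _).le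

/-- The power is a Gamma integral of exponentials in |x|²+t; Tonelli leaves a Gaussian in x, then
another Gamma integral in l. -/
theorem lintegral_norm_sq_add_rpow_neg (N : ℕ) {q t : ℝ} (hq : (N : ℝ) / 2 < q) (ht : 0 < t) :
    ∫⁻ x : Euc N, ENNReal.ofReal ((‖x‖ ^ 2 + t) ^ (-q)) =
      ENNReal.ofReal (Real.pi ^ ((N : ℝ) / 2) * Real.Gamma (q - (N : ℝ) / 2) / Real.Gamma q *
        t ^ ((N : ℝ) / 2 - q)) := by
  have hq0 : 0 < q := lt_of_le_of_lt (by positivity) hq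
  have hG : 0 < Real.Gamma q := Real.Gamma_pos_of_pos hq0
  have h1 : ∀ x : Euc N, ENNReal.ofReal ((‖x‖ ^ 2 + t) ^ (-q)) =
      ENNReal.ofReal (Real.Gamma q)⁻¹ * ∫⁻ l in Set.Ioi (0 : ℝ),
        ENNReal.ofReal (l ^ (q - 1) * Real.exp (-((‖x‖ ^ 2 + t) * l))) := by
    intro x
    rw [lintegral_rpow_mul_exp_neg hq0 (by positivity), ← ENNReal.ofReal_mul (by positivity)]
    congr 1
    field_simp
  simp_rw [h1]
  rw [lintegral_const_mul' _ _ ENNReal.ofReal_ne_top, lintegral_lintegral_swap]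
  · have h2 : ∀ l ∈ Set.Ioi (0 : ℝ), ∫⁻ x : Euc N,
        ENNReal.ofReal (l ^ (q - 1) * Real.exp (-((‖x‖ ^ 2 + t) * l))) =
        ENNReal.ofReal (Real.pi ^ ((N : ℝ) / 2)) * ENNReal.ofReal
          (l ^ (q - (N : ℝ) / 2 - 1) * Real.exp (-(t * l))) := by
      intro l hl
      have hl0 : (0 : ℝ) < l := hl
      have h3 : ∀ x : Euc N, ENNReal.ofReal (l ^ (q - 1) * Real.exp (-((‖x‖ ^ 2 + t) * l))) =
          ENNReal.ofReal (l ^ (q - 1) * Real.exp (-(t * l))) *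
            ENNReal.ofReal (Real.exp (-l * ‖x‖ ^ 2)) := by
        intro x
        rw [← ENNReal.ofReal_mul (by positivity), mul_assoc, ← Real.exp_add]
        congr 3
        ring
      simp_rw [h3]
      rw [lintegral_const_mul' _ _ ENNReal.ofReal_ne_top, lintegral_exp_neg_mul_norm_sq N hl0,
        ← ENNReal.ofReal_mul (by positivity), ← ENNReal.ofReal_mul (by positivity),
        Real.div_rpow Real.pi_pos.le hl0.le,
        show q - (N : ℝ) / 2 - 1 = (q - 1) - (N : ℝ) / 2 by ring,
        Real.rpow_sub hl0 (q - 1)]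
      congr 1
      ring
    rw [setLIntegral_congr_fun measurableSet_Ioi h2,
      lintegral_const_mul' _ _ ENNReal.ofReal_ne_top,
      lintegral_rpow_mul_exp_neg (by linarith) ht, ← ENNReal.ofReal_mul (by positivity),
      ← ENNReal.ofReal_mul (by positivity), neg_sub]
    congr 1
    ring
  · fun_prop

/-- The fundamental theorem of calculus. It replaces a difference whose terms are not separately
integrable over ℝ^N by a positive superposition, so that Tonelli applies. -/
theorem rpow_neg_sub_eq_lintegral {a c K : ℝ} (ha : 0 < a) (hc : 0 < c) (hK : 0 ≤ K) :
    ENNReal.ofReal (c ^ (-a) - (c + K) ^ (-a)) =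
      ∫⁻ t in Set.Ioc 0 K, ENNReal.ofReal (a * (c + t) ^ (-(a + 1))) := by
  have hd : ∀ t ∈ Set.uIcc 0 K, HasDerivAt (fun t => -(c + t) ^ (-a))
      (a * (c + t) ^ (-(a + 1))) t := by
    intro t ht
    rw [Set.uIcc_of_le hK] at ht
    have h := (((hasDerivAt_id t).const_add c).rpow_const (p := -a)
      (Or.inl (by simpa using (by linarith [ht.1] : c + t ≠ 0)))).neg
    refine h.congr_deriv ?_
    rw [neg_add', id]
    ring
  have hcont : ContinuousOn (fun t => a * (c + t) ^ (-(a + 1))) (Set.uIcc 0 K) := by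
    rw [Set.uIcc_of_le hK]
    refine continuousOn_const.mul (ContinuousOn.rpow_const (by fun_prop) fun t ht => Or.inl ?_)
    linarith [ht.1]
  have hint := intervalIntegral.integral_eq_sub_of_hasDerivAt hd hcont.intervalIntegrable
  have hI : IntegrableOn (fun t => a * (c + t) ^ (-(a + 1))) (Set.Ioc 0 K) :=
    (intervalIntegrable_iff_integrableOn_Ioc_of_le hK).1 hcont.intervalIntegrable
  rw [intervalIntegral.integral_of_le hK] at hint
  rw [← ofReal_integral_eq_lintegral_ofReal hI, hint]
  · congr 1
    rw [add_zero]; ring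
  · filter_upwards [self_mem_ae_restrict measurableSet_Ioc] with t ht
    have : 0 < c + t := by linarith [ht.1]
    simp only [Pi.zero_apply]
    positivity

theorem lintegral_rpow_Ioc {s K : ℝ} (hs : 0 < s) (hK : 0 ≤ K) :
    ∫⁻ t in Set.Ioc 0 K, ENNReal.ofReal (t ^ (s - 1)) = ENNReal.ofReal (K ^ s / s) := by
  have hI := intervalIntegral.intervalIntegrable_rpow' (a := 0) (b := K)
    (r := s - 1) (by linarith)
  have hval := integral_rpow (a := 0) (b := K) (r := s - 1) (Or.inl (by linarith))
  rw [intervalIntegral.integral_of_le hK] at hval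
  rw [← ofReal_integral_eq_lintegral_ofReal
    ((intervalIntegrable_iff_integrableOn_Ioc_of_le hK).1 hI), hval]
  · simp [Real.zero_rpow hs.ne']
  · filter_upwards [self_mem_ae_restrict measurableSet_Ioc] with t ht
    exact Real.rpow_nonneg ht.1.le _

/-- `∫ (|x|^(-2a) - (|x|²+k²)^(-a)) dx` for `a = (N - 2s)/2`. -/
theorem lintegral_norm_rpow_sub {N : ℕ} {s k : ℝ} (hs0 : 0 < s) (hs1 : s < 1)
    (hsN : 2 * s < (N : ℝ)) (hk : 0 < k) :
    ∫⁻ x : Euc N, ENNReal.ofReal ((‖x‖ ^ 2) ^ (-(((N : ℝ) - 2 * s) / 2)) -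
        (‖x‖ ^ 2 + k ^ 2) ^ (-(((N : ℝ) - 2 * s) / 2))) =
      ENNReal.ofReal (Real.pi ^ ((N : ℝ) / 2) * Real.Gamma (1 - s) /
        (s * Real.Gamma ((N : ℝ) / 2 - s)) * (k ^ 2) ^ s) := by
  set a : ℝ := ((N : ℝ) - 2 * s) / 2 with ha
  have ha0 : 0 < a := by rw [ha]; linarith
  have hN : N ≠ 0 := by
    rintro rfl
    norm_num at hsN
    linarith
  have : Nontrivial (Euc N) := by
    have : Nonempty (Fin N) := Fin.pos_iff_nonempty.1 (Nat.pos_of_ne_zero hN)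
    infer_instance
  have h1 : ∀ᵐ x : Euc N, ENNReal.ofReal ((‖x‖ ^ 2) ^ (-a) - (‖x‖ ^ 2 + k ^ 2) ^ (-a)) =
      ∫⁻ t in Set.Ioc 0 (k ^ 2), ENNReal.ofReal (a * (‖x‖ ^ 2 + t) ^ (-(a + 1))) := by
    filter_upwards [Measure.ae_ne volume (0 : Euc N)] with x hx
    exact rpow_neg_sub_eq_lintegral ha0 (by positivity) (by positivity)
  rw [lintegral_congr_ae h1, lintegral_lintegral_swap]
  · have hG : 0 < Real.Gamma a := Real.Gamma_pos_of_pos ha0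
    have hG1 : 0 < Real.Gamma (1 - s) := Real.Gamma_pos_of_pos (by linarith)
    -- Here a+1 = N/2+1-s exceeds N/2, so the x-integral converges; it scales as t^(s-1), integrable
    -- at 0 because s > 0.
    have h2 : ∀ t ∈ Set.Ioc 0 (k ^ 2), ∫⁻ x : Euc N,
        ENNReal.ofReal (a * (‖x‖ ^ 2 + t) ^ (-(a + 1))) =
        ENNReal.ofReal (Real.pi ^ ((N : ℝ) / 2) * Real.Gamma (1 - s) / Real.Gamma a) *
          ENNReal.ofReal (t ^ (s - 1)) := by
      intro t ht
      have h3 : ∀ x : Euc N, ENNReal.ofReal (a * (‖x‖ ^ 2 + t) ^ (-(a + 1))) =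
          ENNReal.ofReal a * ENNReal.ofReal ((‖x‖ ^ 2 + t) ^ (-(a + 1))) :=
        fun x => ENNReal.ofReal_mul ha0.le
      simp_rw [h3]
      rw [lintegral_const_mul' _ _ ENNReal.ofReal_ne_top,
        lintegral_norm_sq_add_rpow_neg N (by rw [ha]; linarith) ht.1,
        ← ENNReal.ofReal_mul ha0.le, ← ENNReal.ofReal_mul (by positivity),
        Real.Gamma_add_one ha0.ne', show a + 1 - (N : ℝ) / 2 = 1 - s by rw [ha]; ring,
        show (N : ℝ) / 2 - (a + 1) = s - 1 by rw [ha]; ring]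
      congr 1
      field_simp
    rw [setLIntegral_congr_fun measurableSet_Ioc h2,
      lintegral_const_mul' _ _ ENNReal.ofReal_ne_top, lintegral_rpow_Ioc hs0 (by positivity),
      ← ENNReal.ofReal_mul (by positivity), show (N : ℝ) / 2 - s = a by rw [ha]; ring]
    congr 1
    field_simp
  · fun_prop

/-! ### The surface measure in stereographic coordinates -/

/-- Append a last coordinate to a point of `ℝ^N`. -/
noncomputable def appendLast {N : ℕ} (p : ℝ × Euc N) : Euc (N + 1) :=
  WithLp.toLp 2 (Fin.snoc (α := fun _ => ℝ) (fun i => p.2 i) p.1)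

theorem measurePreserving_appendLast (N : ℕ) :
    MeasurePreserving (appendLast (N := N)) (volume.prod volume) volume := by
  have h1 : MeasurePreserving (WithLp.ofLp : Euc N → Fin N → ℝ) volume volume :=
    EuclideanSpace.volume_preserving_symm_measurableEquiv_toLp (Fin N)
  have h2 := (volume_preserving_piFinSuccAbove (fun _ : Fin (N + 1) => ℝ) (Fin.last N)).symm
  have h3 := PiLp.volume_preserving_toLp (Fin (N + 1))
  have h4 := (MeasurePreserving.id (volume : Measure ℝ)).prod h1
  have h5 := h3.comp (h2.comp h4)
  have h6 : appendLast (N := N) = WithLp.toLp 2 ∘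
      (MeasurableEquiv.piFinSuccAbove (fun _ : Fin (N + 1) => ℝ) (Fin.last N)).symm ∘
        Prod.map id WithLp.ofLp := by
    funext p
    simp [appendLast, MeasurableEquiv.piFinSuccAbove_symm_apply, Fin.insertNthEquiv]
  rw [h6]
  exact h5

theorem measurable_appendLast (N : ℕ) : Measurable (appendLast (N := N)) :=
  (measurePreserving_appendLast N).measurable

/-- For p = (t, p') put τ = t+|p| and y = p'/τ: y is the stereographic image of p/|p|, and |p| =
τ/J(y). Cones over the sphere are thus simple in (τ, y). -/
theorem appendLast_smul {N : ℕ} (y : Euc N) (τ : ℝ) :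
    appendLast (τ * (1 - ‖y‖ ^ 2) / 2, τ • y) =
      (τ / confFactor y) • (stereoInv y : Euc (N + 1)) := by
  have hy := one_add_norm_sq_pos y
  ext i
  refine Fin.lastCases ?_ (fun j => ?_) i
  · rw [PiLp.smul_apply, coe_stereoInv_last]
    simp only [appendLast, Fin.snoc_last, confFactor, smul_eq_mul]
    field_simp
  · rw [PiLp.smul_apply, coe_stereoInv_castSucc]
    simp only [appendLast, Fin.snoc_castSucc, confFactor, smul_eq_mul, PiLp.smul_apply]
    field_simp

theorem lintegral_eq_smul {N : ℕ} {τ : ℝ} (hτ : 0 < τ) (f : Euc N → ENNReal) :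
    ∫⁻ y, f y = ENNReal.ofReal (τ ^ N) * ∫⁻ y, f (τ • y) := by
  have h := Measure.map_addHaar_smul (volume : Measure (Euc N)) hτ.ne'
  rw [finrank_euclideanSpace_fin, abs_of_pos (by positivity)] at h
  have h2 := lintegral_map_equiv (μ := (volume : Measure (Euc N))) f
    (Homeomorph.smulOfNeZero τ hτ.ne').toMeasurableEquiv
  have h3 : ⇑(Homeomorph.smulOfNeZero (α := Euc N) τ hτ.ne').toMeasurableEquiv =
    fun x => τ • x := rfl
  rw [h3, h, lintegral_smul_measure, smul_eq_mul] at h2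
  rw [← h2, ← mul_assoc, ← ENNReal.ofReal_mul (by positivity), mul_inv_cancel₀ (by positivity),
    ENNReal.ofReal_one, one_mul]

/-- The substitution `t = τ/2 - c/(2τ)`, mapping `(0, ∞)` onto `ℝ`. -/
theorem lintegral_eq_lintegral_Ioi {c : ℝ} (hc : 0 < c) (f : ℝ → ENNReal) :
    ∫⁻ t, f t = ∫⁻ τ in Set.Ioi (0 : ℝ),
      ENNReal.ofReal (1 / 2 + c / (2 * τ ^ 2)) * f (τ / 2 - c / (2 * τ)) := by
  have hd : ∀ τ ∈ Set.Ioi (0 : ℝ), HasDerivWithinAt (fun τ => τ / 2 - c / (2 * τ))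
      (1 / 2 + c / (2 * τ ^ 2)) (Set.Ioi 0) τ := by
    intro τ hτ
    have hτ0 : τ ≠ 0 := ne_of_gt hτ
    have h1 : HasDerivAt (fun τ : ℝ => 2 * τ) 2 τ := by
      simpa using (hasDerivAt_id τ).const_mul 2
    have h2 := ((hasDerivAt_id τ).div_const 2).sub
      ((hasDerivAt_const τ c).div h1 (by positivity))
    refine (h2.congr_deriv ?_).hasDerivWithinAt
    field_simp
    ring
  have hinj : Set.InjOn (fun τ => τ / 2 - c / (2 * τ)) (Set.Ioi 0) := by
    intro p hp q hq h
    have hp0 : 0 < p := hp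
    have hq0 : 0 < q := hq
    simp only at h
    field_simp at h
    have h2 : (p - q) * (p * q + c) = 0 := by linarith
    rcases mul_eq_zero.1 h2 with h3 | h3
    · linarith
    · nlinarith [mul_pos hp0 hq0]
  have himg : (fun τ => τ / 2 - c / (2 * τ)) '' Set.Ioi 0 = Set.univ := by
    refine Set.eq_univ_of_forall fun t => ?_
    have hs : Real.sqrt (t ^ 2 + c) ^ 2 = t ^ 2 + c := Real.sq_sqrt (by positivity)
    have hlt : |t| < Real.sqrt (t ^ 2 + c) := by
      rw [← Real.sqrt_sq_eq_abs]
      exact Real.sqrt_lt_sqrt (by positivity) (by linarith)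
    have hpos : 0 < t + Real.sqrt (t ^ 2 + c) := by linarith [neg_abs_le t]
    -- The positive root of τ² - 2tτ - c = 0.
    refine ⟨t + Real.sqrt (t ^ 2 + c), hpos, ?_⟩
    simp only
    field_simp
    nlinarith
  have h := lintegral_image_eq_lintegral_abs_deriv_mul measurableSet_Ioi hd hinj f
  rw [himg, Measure.restrict_univ] at h
  rw [h]
  refine setLIntegral_congr_fun measurableSet_Ioi fun τ hτ => ?_
  have : 0 < 1 / 2 + c / (2 * τ ^ 2) := by positivity
  simp only [abs_of_pos this]

theorem lintegral_pow_Ioo {n : ℕ} {b : ℝ} (hb : 0 ≤ b) :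
    ∫⁻ t in Set.Ioo 0 b, ENNReal.ofReal (t ^ n) = ENNReal.ofReal (b ^ (n + 1) / (n + 1)) := by
  rw [restrict_Ioo_eq_restrict_Ioc, ← ofReal_integral_eq_lintegral_ofReal
    (intervalIntegral.intervalIntegrable_pow n).1, ← intervalIntegral.integral_of_le hb]
  · simp
  · filter_upwards [self_mem_ae_restrict measurableSet_Ioc] with t ht
    exact pow_nonneg ht.1.le _

/-- The open truncated cone over a subset of the sphere. -/
def truncCone {N : ℕ} (A : Set (Sph N)) : Set (Euc (N + 1)) :=
  {p | ∃ r ∈ Set.Ioo (0 : ℝ) 1, ∃ ζ ∈ A, p = r • (ζ : Euc (N + 1))}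

/-- Membership expressed through p/|p|, from which measurability follows. -/
theorem truncCone_eq {N : ℕ} (A : Set (Sph N)) :
    truncCone A = {p | p ≠ 0 ∧ ‖p‖ < 1 ∧ ∃ ζ ∈ A, (ζ : Euc (N + 1)) = ‖p‖⁻¹ • p} := by
  ext p
  constructor
  · rintro ⟨r, hr, ζ, hζ, rfl⟩
    have h1 : ‖r • (ζ : Euc (N + 1))‖ = r := by
      rw [norm_smul, norm_eq_of_mem_sphere, mul_one, Real.norm_of_nonneg hr.1.le]
    refine ⟨?_, by rw [h1]; exact hr.2, ζ, hζ, ?_⟩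
    · rw [← norm_ne_zero_iff, h1]; exact hr.1.ne'
    · rw [h1, smul_smul, inv_mul_cancel₀ hr.1.ne', one_smul]
  · rintro ⟨h0, h1, ζ, hζ, h⟩
    have h2 := norm_pos_iff.2 h0
    exact ⟨‖p‖, ⟨h2, h1⟩, ζ, hζ, by rw [h, smul_smul, mul_inv_cancel₀ h2.ne', one_smul]⟩

theorem measurableSet_truncCone {N : ℕ} {A : Set (Sph N)} (hA : MeasurableSet A) :
    MeasurableSet (truncCone A) := by
  have h1 : MeasurableSet (Subtype.val '' A : Set (Euc (N + 1))) :=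
    (MeasurableEmbedding.subtype_coe Metric.isClosed_sphere.measurableSet).measurableSet_image.2 hA
  have h2 : Measurable fun p : Euc (N + 1) => ‖p‖⁻¹ • p := by fun_prop
  have h3 : truncCone A = {p | p ≠ 0} ∩ ({p | ‖p‖ < 1} ∩
      ((fun p : Euc (N + 1) => ‖p‖⁻¹ • p) ⁻¹' (Subtype.val '' A))) := by
    rw [truncCone_eq]
    ext p
    simp [eq_comm]
  rw [h3]
  exact (measurableSet_singleton (0 : Euc (N + 1))).compl.inter
    ((measurableSet_lt measurable_norm measurable_const).inter (h2 h1))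

theorem smul_stereoInv_mem_truncCone {N : ℕ} {A : Set (Sph N)} {y : Euc N} {r : ℝ}
    (hr : 0 < r) :
    r • (stereoInv y : Euc (N + 1)) ∈ truncCone A ↔ r < 1 ∧ stereoInv y ∈ A := by
  constructor
  · rintro ⟨r', hr', ζ, hζ, h⟩
    have h1 := congrArg norm h
    rw [norm_smul, norm_smul, norm_eq_of_mem_sphere, norm_eq_of_mem_sphere, mul_one, mul_one,
      Real.norm_of_nonneg hr.le, Real.norm_of_nonneg hr'.1.le] at h1
    subst h1
    refine ⟨hr'.2, ?_⟩
    rw [Subtype.ext (smul_right_injective _ hr.ne' h)]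
    exact hζ
  · rintro ⟨h1, h2⟩
    exact ⟨r, ⟨hr, h1⟩, _, h2, rfl⟩

/-- In the coordinates (τ, y) of `appendLast_smul` the cone is {0 < τ < J(y), stereoInv y ∈ A} and
Lebesgue measure is J(y)⁻¹ τ^N dτ dy; integrating τ^N up to J(y) gives J(y)^(N+1)/(N+1). -/
theorem volume_truncCone {N : ℕ} (hN : N ≠ 0) {A : Set (Sph N)} (hA : MeasurableSet A) :
    volume (truncCone A) =
      ∫⁻ y in stereoInv ⁻¹' A, ENNReal.ofReal (confFactor y ^ N / (N + 1)) := by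
  have : Nontrivial (Euc N) := by
    have : Nonempty (Fin N) := Fin.pos_iff_nonempty.1 (Nat.pos_of_ne_zero hN)
    infer_instance
  have hC := measurableSet_truncCone hA
  set F : Euc (N + 1) → ENNReal := (truncCone A).indicator 1 with hF
  have hFm : Measurable F := measurable_one.indicator hC
  have hA' : MeasurableSet (stereoInv ⁻¹' A) := (continuous_stereoInv N).measurable hA
  have key : ∀ (y : Euc N) (τ : ℝ), 0 < τ → F (appendLast (τ * (1 - ‖y‖ ^ 2) / 2, τ • y)) =
      (Set.Ioo 0 (confFactor y)).indicator 1 τ * (stereoInv ⁻¹' A).indicator 1 y := by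
    intro y τ hτ
    have hJ := confFactor_pos y
    rw [appendLast_smul, hF]
    have h1 := smul_stereoInv_mem_truncCone (A := A) (y := y) (div_pos hτ hJ)
    rw [div_lt_one hJ] at h1
    by_cases h2 : τ < confFactor y <;> by_cases h3 : stereoInv y ∈ A <;>
      simp [Set.indicator, h1, h2, h3, hτ]
  have hsub1 : ∀ᵐ y : Euc N, ∫⁻ t : ℝ, F (appendLast (t, y)) = ∫⁻ τ in Set.Ioi (0 : ℝ),
      ENNReal.ofReal (1 / 2 + ‖y‖ ^ 2 / (2 * τ ^ 2)) *
        F (appendLast (τ / 2 - ‖y‖ ^ 2 / (2 * τ), y)) := by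
    filter_upwards [Measure.ae_ne volume (0 : Euc N)] with y hy
    exact lintegral_eq_lintegral_Ioi (by positivity) _
  -- After rescaling y to τy, the factor 1/2 + |τy|²/(2τ²) is 1/J(y), free of τ.
  have hsub2 : ∀ τ ∈ Set.Ioi (0 : ℝ), ∫⁻ y : Euc N,
      ENNReal.ofReal (1 / 2 + ‖y‖ ^ 2 / (2 * τ ^ 2)) *
        F (appendLast (τ / 2 - ‖y‖ ^ 2 / (2 * τ), y)) =
      ∫⁻ y : Euc N, ENNReal.ofReal (τ ^ N) * (ENNReal.ofReal (confFactor y)⁻¹ *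
        ((Set.Ioo 0 (confFactor y)).indicator 1 τ * (stereoInv ⁻¹' A).indicator 1 y)) := by
    intro τ hτ
    have hτ0 : 0 < τ := hτ
    rw [lintegral_eq_smul hτ0, lintegral_const_mul' _ _ ENNReal.ofReal_ne_top]
    congr 1
    refine lintegral_congr fun y => ?_
    rw [← key y τ hτ, norm_smul, Real.norm_of_nonneg hτ0.le]
    congr 3
    · unfold confFactor; field_simp
    · congr 1; field_simp
  have hm2 : Measurable fun p : ℝ × Euc N =>
      (Set.Ioo 0 (confFactor p.2)).indicator (1 : ℝ → ENNReal) p.1 := by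
    have : (fun p : ℝ × Euc N => (Set.Ioo 0 (confFactor p.2)).indicator (1 : ℝ → ENNReal) p.1) =
        {p : ℝ × Euc N | 0 < p.1 ∧ p.1 < confFactor p.2}.indicator 1 := by
      funext p
      simp [Set.indicator]
    rw [this]
    refine measurable_one.indicator ?_
    exact (measurableSet_lt measurable_const measurable_fst).inter
      (measurableSet_lt measurable_fst ((continuous_confFactor N).measurable.comp measurable_snd))
  have hm3 : Measurable fun p : ℝ × Euc N =>
      (stereoInv ⁻¹' A).indicator (1 : Euc N → ENNReal) p.2 :=
    (measurable_one.indicator hA').comp measurable_snd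
  have hJm : Measurable fun y : Euc N => ENNReal.ofReal (confFactor y)⁻¹ :=
    (continuous_confFactor N).measurable.inv.ennreal_ofReal
  have hm4 : AEMeasurable (Function.uncurry fun (τ : ℝ) (y : Euc N) => ENNReal.ofReal (τ ^ N) *
      (ENNReal.ofReal (confFactor y)⁻¹ * ((Set.Ioo 0 (confFactor y)).indicator 1 τ *
        (stereoInv ⁻¹' A).indicator 1 y)))
      ((volume.restrict (Set.Ioi 0)).prod volume) := by
    refine Measurable.aemeasurable ?_
    exact (measurable_fst.pow_const N).ennreal_ofReal.mul
      ((hJm.comp measurable_snd).mul (hm2.mul hm3))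
  calc volume (truncCone A) = ∫⁻ p, F p := by
        rw [hF, lintegral_indicator_one hC]
    _ = ∫⁻ p, F (appendLast p) ∂(volume.prod volume) :=
        ((measurePreserving_appendLast N).lintegral_comp hFm).symm
    _ = ∫⁻ y : Euc N, ∫⁻ t : ℝ, F (appendLast (t, y)) :=
        lintegral_prod_symm' _ (hFm.comp (measurable_appendLast N))
    _ = ∫⁻ y : Euc N, ∫⁻ τ in Set.Ioi (0 : ℝ),
          ENNReal.ofReal (1 / 2 + ‖y‖ ^ 2 / (2 * τ ^ 2)) *
          F (appendLast (τ / 2 - ‖y‖ ^ 2 / (2 * τ), y)) := lintegral_congr_ae hsub1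
    _ = ∫⁻ τ in Set.Ioi (0 : ℝ), ∫⁻ y : Euc N,
          ENNReal.ofReal (1 / 2 + ‖y‖ ^ 2 / (2 * τ ^ 2)) *
          F (appendLast (τ / 2 - ‖y‖ ^ 2 / (2 * τ), y)) := by
        refine lintegral_lintegral_swap (Measurable.aemeasurable ?_)
        refine Measurable.mul (by fun_prop) ((hFm.comp (measurable_appendLast N)).comp ?_)
        fun_prop
    _ = _ := by
        rw [setLIntegral_congr_fun measurableSet_Ioi hsub2, lintegral_lintegral_swap hm4,
          ← lintegral_indicator hA']
        refine lintegral_congr fun y => ?_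
        have hJ := confFactor_pos y
        have h1 : ∀ τ : ℝ, ENNReal.ofReal (τ ^ N) * (ENNReal.ofReal (confFactor y)⁻¹ *
            ((Set.Ioo 0 (confFactor y)).indicator 1 τ * (stereoInv ⁻¹' A).indicator 1 y)) =
            (ENNReal.ofReal (confFactor y)⁻¹ * (stereoInv ⁻¹' A).indicator 1 y) *
            (Set.Ioo 0 (confFactor y)).indicator (fun τ => ENNReal.ofReal (τ ^ N)) τ := by
          intro τ
          by_cases h2 : τ ∈ Set.Ioo 0 (confFactor y)
          · simp only [Set.indicator_of_mem h2, Pi.one_apply]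
            ring
          · simp [Set.indicator_of_notMem h2]
        simp_rw [h1]
        rw [lintegral_const_mul' _ _ (ENNReal.mul_ne_top ENNReal.ofReal_ne_top
            (by simp only [Set.indicator]; split_ifs <;> simp)),
          setLIntegral_indicator measurableSet_Ioo,
          Set.inter_eq_left.2 (Set.Ioo_subset_Ioi_self), lintegral_pow_Ioo hJ.le]
        by_cases h2 : y ∈ stereoInv ⁻¹' A
        · rw [Set.indicator_of_mem h2, Set.indicator_of_mem h2, Pi.one_apply, mul_one,
            ← ENNReal.ofReal_mul (by positivity)]
          congr 1
          rw [pow_succ]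
          field_simp
        · simp [Set.indicator_of_notMem h2]

open scoped Pointwise in
/-- The surface measure of the sphere in stereographic coordinates. -/
theorem sphVol_eq_map {N : ℕ} (hN : N ≠ 0) :
    sphVol N = (volume.withDensity fun y => ENNReal.ofReal (confFactor y ^ N)).map stereoInv := by
  ext A hA
  have hA' : MeasurableSet (stereoInv ⁻¹' A) := (continuous_stereoInv N).measurable hA
  have h1 : Set.Ioo (0 : ℝ) 1 • (Subtype.val '' A : Set (Euc (N + 1))) = truncCone A := by
    ext p
    simp only [Set.mem_smul, truncCone, Set.mem_ofPred_eq, Set.mem_image]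
    constructor
    · rintro ⟨r, hr, _, ⟨ζ, hζ, rfl⟩, rfl⟩
      exact ⟨r, hr, ζ, hζ, rfl⟩
    · rintro ⟨r, hr, ζ, hζ, rfl⟩
      exact ⟨r, hr, _, ⟨ζ, hζ, rfl⟩, rfl⟩
  -- `toSphere` is N+1 times the volume of the cone, which cancels the 1/(N+1).
  rw [Measure.toSphere_apply' _ hA, h1, volume_truncCone hN hA,
    Measure.map_apply (continuous_stereoInv N).measurable hA, withDensity_apply _ hA',
    finrank_euclideanSpace_fin, ← lintegral_const_mul' _ _ (ENNReal.natCast_ne_top _)]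
  refine lintegral_congr fun y => ?_
  rw [← ENNReal.ofReal_natCast, ← ENNReal.ofReal_mul (by positivity)]
  congr 1
  push_cast
  field_simp

/-! ### Inversion about the singular point -/

/-- The inversion `η ↦ x + η/|η|²`, fixing the value `x` at `0`. -/
noncomputable def invMap {N : ℕ} (x η : Euc N) : Euc N := x + (‖η‖ ^ 2)⁻¹ • η

theorem invMap_sub {N : ℕ} (x η : Euc N) : invMap x η - x = (‖η‖ ^ 2)⁻¹ • η := by
  simp [invMap]

theorem norm_sub_invMap {N : ℕ} (x η : Euc N) : ‖x - invMap x η‖ = ‖η‖⁻¹ := by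
  rw [norm_sub_rev, invMap_sub, norm_smul, norm_inv, norm_pow, norm_norm]
  by_cases h : ‖η‖ = 0
  · simp [h]
  · field_simp

/-- Because 0⁻¹ = 0, the identity holds at y = x too, and the inversion is a bijection of all of
ℝ^N. -/
theorem invMap_invMap_sub {N : ℕ} (x y : Euc N) : invMap x (invMap 0 (y - x)) = y := by
  have h : ‖invMap 0 (y - x)‖ = ‖y - x‖⁻¹ := by simpa using norm_sub_invMap 0 (y - x)
  rw [invMap, h, invMap, zero_add, smul_smul]
  by_cases h0 : ‖y - x‖ = 0
  · have : y - x = 0 := norm_eq_zero.1 h0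
    rw [this, smul_zero, add_zero, sub_eq_zero.1 this]
  · have : ((‖y - x‖⁻¹ ^ 2)⁻¹ * (‖y - x‖ ^ 2)⁻¹) = 1 := by field_simp
    rw [this, one_smul, add_sub_cancel]

theorem invMap_sub_invMap {N : ℕ} (x η : Euc N) : invMap 0 (invMap x η - x) = η := by
  have := invMap_invMap_sub 0 η
  rw [sub_zero] at this
  rwa [show invMap x η - x = invMap 0 η by simp [invMap]]

theorem invMap_injective {N : ℕ} (x : Euc N) : Function.Injective (invMap x) :=
  Function.LeftInverse.injective (g := fun y => invMap 0 (y - x)) (invMap_sub_invMap x)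

theorem invMap_surjective {N : ℕ} (x : Euc N) : Function.Surjective (invMap x) :=
  fun y => ⟨_, invMap_invMap_sub x y⟩

theorem measurable_invMap {N : ℕ} (x : Euc N) : Measurable (invMap x) := by
  unfold invMap; fun_prop

/-- The derivative is |η|⁻² times the reflection in the hyperplane orthogonal to η, of determinant
±1. -/
theorem hasFDerivAt_invMap {N : ℕ} (x : Euc N) {η : Euc N} (hη : η ≠ 0) :
    ∃ L : Euc N →L[ℝ] Euc N, HasFDerivAt (invMap x) L η ∧ |L.det| = ((‖η‖ ^ 2)⁻¹) ^ N := by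
  have h := EuclideanGeometry.hasFDerivAt_inversion (c := (0 : Euc N)) (R := 1) hη
  have h1 : invMap x = fun η => x + EuclideanGeometry.inversion (0 : Euc N) 1 η := by
    funext η
    simp [invMap, EuclideanGeometry.inversion_def]
  refine ⟨_, h1 ▸ h.const_add x, ?_⟩
  rw [ContinuousLinearMap.det, ContinuousLinearMap.toLinearMap_smul, LinearMap.det_smul,
    finrank_euclideanSpace_fin]
  have h2 := Submodule.det_reflection (𝕜 := ℝ) (ℝ ∙ (η - 0))ᗮ
  have h3 : ((((ℝ ∙ (η - 0))ᗮ.reflection : Euc N ≃L[ℝ] Euc N) : Euc N →L[ℝ] Euc N) :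
      Euc N →ₗ[ℝ] Euc N) = ((ℝ ∙ (η - 0))ᗮ.reflection.toLinearEquiv : Euc N →ₗ[ℝ] Euc N) := rfl
  rw [h3, h2, abs_mul, abs_pow (-1 : ℝ), abs_neg, abs_one, one_pow, mul_one, dist_zero_right,
    abs_of_nonneg (by positivity), one_div, inv_pow]

/-- The pull-back of a density under the inversion `invMap x`. -/
noncomputable def invPull {N : ℕ} (x : Euc N) (f : Euc N → ℝ) (η : Euc N) : ℝ :=
  ((‖η‖ ^ 2)⁻¹) ^ N * f (invMap x η)

theorem ne_zero_of_mem_preimage_invMap {N : ℕ} {x : Euc N} {P : Set (Euc N)} (hx : x ∉ P)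
    {η : Euc N} (hη : η ∈ invMap x ⁻¹' P) : η ≠ 0 := by
  rintro rfl
  exact hx (by simpa [invMap] using hη)

/-- Since x ∉ P, the preimage avoids η = 0, the only point where the derivative formula fails; the
rest is the change of variables formula. -/
theorem setIntegral_eq_invPull {N : ℕ} {x : Euc N} {P : Set (Euc N)} (hP : MeasurableSet P)
    (hx : x ∉ P) (f : Euc N → ℝ) :
    (∫ y in P, f y = ∫ η in invMap x ⁻¹' P, invPull x f η) ∧
      (IntegrableOn f P ↔ IntegrableOn (invPull x f) (invMap x ⁻¹' P)) := by
  choose! L hL hdet using fun (η : Euc N) (hη : η ≠ 0) => hasFDerivAt_invMap x hη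
  have hm : MeasurableSet (invMap x ⁻¹' P) := measurable_invMap x hP
  have hd : ∀ η ∈ invMap x ⁻¹' P, HasFDerivWithinAt (invMap x) (L η) (invMap x ⁻¹' P) η :=
    fun η hη => (hL η (ne_zero_of_mem_preimage_invMap hx hη)).hasFDerivWithinAt
  have hEq : Set.EqOn (fun η => |(L η).det| • f (invMap x η)) (invPull x f)
      (invMap x ⁻¹' P) := by
    intro η hη
    simp only [hdet η (ne_zero_of_mem_preimage_invMap hx hη), smul_eq_mul, invPull]
  have himg := Set.image_preimage_eq P (invMap_surjective x)
  have h1 := integral_image_eq_integral_abs_det_fderiv_smul volume hm hd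
    (invMap_injective x).injOn f
  have h2 := integrableOn_image_iff_integrableOn_abs_det_fderiv_smul volume hm hd
    (invMap_injective x).injOn f
  rw [himg] at h1 h2
  rw [h1, h2]
  exact ⟨setIntegral_congr_fun hm hEq, integrableOn_congr_fun hEq hm⟩

/-- The puncture stands for y = ∞: by convention η = 0 is sent to x, which lies outside the
truncated domain. -/
theorem preimage_invMap_dist {N : ℕ} (x : Euc N) {R : ℝ} (hR : 0 < R) :
    invMap x ⁻¹' {y | R⁻¹ < dist x y} = Metric.ball 0 R \ {0} := by
  ext η
  simp only [Set.mem_preimage, Set.mem_ofPred_eq, dist_eq_norm, norm_sub_invMap, Set.mem_sdiff,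
    Metric.mem_ball, sub_zero, Set.mem_singleton_iff]
  by_cases h : η = 0
  · simp [h, hR.le]
  · have := norm_pos_iff.2 h
    simp [h, inv_lt_inv₀ hR this]

theorem confFactor_invMap {N : ℕ} (x : Euc N) {η : Euc N} (hη : η ≠ 0) :
    confFactor (invMap x η) = confFactor x * ‖η‖ ^ 2 /
      (‖η + (confFactor x / 2) • x‖ ^ 2 + (confFactor x / 2) ^ 2) := by
  have h0 : 0 < ‖η‖ := norm_pos_iff.2 hη
  have hx := one_add_norm_sq_pos x
  have h1 : ‖invMap x η‖ ^ 2 = ‖x‖ ^ 2 + 2 * ((‖η‖ ^ 2)⁻¹ * inner ℝ x η) + (‖η‖ ^ 2)⁻¹ := by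
    rw [invMap, norm_add_sq_real, norm_smul, inner_smul_right, norm_inv, norm_pow, norm_norm]
    field_simp
  have h2 : ‖η + (confFactor x / 2) • x‖ ^ 2 = ‖η‖ ^ 2 + confFactor x * inner ℝ x η +
      (confFactor x / 2) ^ 2 * ‖x‖ ^ 2 := by
    rw [norm_add_sq_real, norm_smul, inner_smul_right, mul_pow, real_inner_comm,
      Real.norm_of_nonneg (by linarith [confFactor_pos x])]
    ring
  -- Completing the square in (1+|x|²)|η|² + 2⟨x,η⟩ + 1, with 1+|x|² = 2/J(x).
  have h3 : ‖η + (confFactor x / 2) • x‖ ^ 2 + (confFactor x / 2) ^ 2 =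
      confFactor x / 2 * ‖η‖ ^ 2 * (1 + ‖invMap x η‖ ^ 2) := by
    rw [h2, h1]
    unfold confFactor
    field_simp
    ring
  have h4 := one_add_norm_sq_pos (invMap x η)
  have h5 := confFactor_pos x
  rw [h3, confFactor]
  field_simp

theorem dist_stereoInv_invMap_sq {N : ℕ} (x : Euc N) {η : Euc N} (hη : η ≠ 0) :
    dist (stereoInv x) (stereoInv (invMap x η)) ^ 2 = confFactor x ^ 2 /
      (‖η + (confFactor x / 2) • x‖ ^ 2 + (confFactor x / 2) ^ 2) := by
  have h0 : 0 < ‖η‖ := norm_pos_iff.2 hη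
  rw [Subtype.dist_eq, dist_eq_norm, norm_stereoInv_sub_sq, norm_sub_invMap,
    confFactor_invMap x hη]
  field_simp

/-- By `dist_stereoInv_invMap_sq` the chordal distance decreases with the distance from η to
-(J/2)x. The centre is therefore independent of ε, and `h` relates the radius to ε. -/
theorem preimage_invMap_chord {N : ℕ} (x : Euc N) {R ε : ℝ} (hR : 0 < R) (hε : 0 < ε)
    (h : (R ^ 2 + (confFactor x / 2) ^ 2) * ε ^ 2 = confFactor x ^ 2) :
    invMap x ⁻¹' {y | ε < dist (stereoInv x) (stereoInv y)} =
      Metric.ball (-((confFactor x / 2) • x)) R \ {0} := by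
  ext η
  by_cases h0 : η = 0
  · simp [h0, invMap, hε.le]
  · have hk := confFactor_pos x
    simp only [Set.mem_preimage, Set.mem_ofPred_eq, Set.mem_sdiff, Metric.mem_ball,
      Set.mem_singleton_iff, h0, not_false_eq_true, and_true, dist_eq_norm η, sub_neg_eq_add]
    rw [← sq_lt_sq₀ hε.le dist_nonneg, dist_stereoInv_invMap_sq x h0,
      lt_div_iff₀ (by positivity), ← h, ← sq_lt_sq₀ (norm_nonneg _) hR.le, mul_comm,
      mul_lt_mul_iff_left₀ (by positivity)]
    constructor <;> intro h <;> linarith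

/-! ### Existence of the Euclidean principal value -/

theorem exists_taylor_bound {N : ℕ} {w : Euc N → ℝ} (hw : ContDiff ℝ 2 w) (x : Euc N) :
    ∃ L : ℝ, 0 ≤ L ∧ ∀ h : Euc N, ‖h‖ ≤ 1 →
      |w (x + h) - w x - fderiv ℝ w x h| ≤ L * ‖h‖ ^ 2 := by
  have h1 : ContDiff ℝ 1 (fderiv ℝ w) := hw.fderiv_right (by norm_num)
  have h2 : Continuous (fderiv ℝ (fderiv ℝ w)) := h1.continuous_fderiv (by norm_num)
  obtain ⟨L, hL⟩ := (isCompact_closedBall x 1).exists_bound_of_continuousOn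
    (f := fderiv ℝ (fderiv ℝ w)) h2.continuousOn
  have hL0 : 0 ≤ L := (norm_nonneg _).trans (hL x (by simp))
  have hlip : ∀ y ∈ Metric.closedBall x 1, ‖fderiv ℝ w y - fderiv ℝ w x‖ ≤ L * ‖y - x‖ :=
    fun y hy => (convex_closedBall x 1).norm_image_sub_le_of_norm_fderiv_le
      (fun z _ => (h1.differentiable (by norm_num)) z) hL (by simp) hy
  refine ⟨L, hL0, fun h hh => ?_⟩
  -- Applying the mean value inequality on the ball of radius |h|, where the derivative varies by at
  -- most L|h|, yields the second factor |h|.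
  have hsub : Metric.closedBall x ‖h‖ ⊆ Metric.closedBall x 1 :=
    Metric.closedBall_subset_closedBall hh
  have h3 := (convex_closedBall x ‖h‖).norm_image_sub_le_of_norm_hasFDerivWithin_le'
    (f := w) (f' := fderiv ℝ w) (φ := fderiv ℝ w x) (C := L * ‖h‖) (x := x) (y := x + h)
    (fun z _ => ((hw.differentiable (by norm_num)) z).hasFDerivAt.hasFDerivWithinAt)
    (fun z hz => (hlip z (hsub hz)).trans
      (mul_le_mul_of_nonneg_left (by simpa [dist_eq_norm] using hz) hL0))
    (by simp) (by simp [dist_eq_norm])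
  rw [add_sub_cancel_left, Real.norm_eq_abs] at h3
  linarith [h3, sq ‖h‖, mul_assoc L ‖h‖ ‖h‖]

theorem exists_lipschitz_bound {N : ℕ} {w : Euc N → ℝ} (hw : ContDiff ℝ 2 w) (x : Euc N) :
    ∃ L : ℝ, 0 ≤ L ∧ ∀ h : Euc N, ‖h‖ ≤ 1 → |w (x + h) - w x| ≤ L * ‖h‖ := by
  obtain ⟨L, hL0, hL⟩ := exists_taylor_bound hw x
  refine ⟨L + ‖fderiv ℝ w x‖, by positivity, fun h hh => ?_⟩
  have h1 := hL h hh
  have h2 := (fderiv ℝ w x).le_opNorm h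
  rw [Real.norm_eq_abs] at h2
  have h3 : L * ‖h‖ ^ 2 ≤ L * ‖h‖ := by
    refine mul_le_mul_of_nonneg_left ?_ hL0
    nlinarith [norm_nonneg h]
  rw [abs_le] at *
  constructor <;> linarith [h1.1, h1.2, h2.1, h2.2]

theorem integrableOn_norm_rpow_neg {N : ℕ} {r δ : ℝ} (hr : (N : ℝ) < r) (hδ : 0 < δ) :
    IntegrableOn (fun h : Euc N => ‖h‖ ^ (-r)) {h | δ < ‖h‖} := by
  have h0 : (0 : ℝ) ≤ r := (Nat.cast_nonneg N).trans hr.le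
  have h1 : Integrable (fun h : Euc N => (1 + ‖h‖) ^ (-r)) :=
    integrable_one_add_norm (by rwa [finrank_euclideanSpace_fin])
  refine Integrable.mono' ((h1.const_mul ((1 + δ⁻¹) ^ r)).integrableOn) ?_ ?_
  · exact (measurable_norm.pow_const _).aestronglyMeasurable
  · filter_upwards [self_mem_ae_restrict (measurableSet_lt measurable_const measurable_norm)]
      with h hh
    have hh' : δ < ‖h‖ := hh
    have hpos : 0 < ‖h‖ := hδ.trans hh'
    rw [Real.norm_of_nonneg (by positivity), Real.rpow_neg hpos.le, Real.rpow_neg (by positivity),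
      ← div_eq_mul_inv, inv_eq_one_div, div_le_div_iff₀ (by positivity) (by positivity), one_mul,
      ← Real.mul_rpow (by positivity) hpos.le]
    refine Real.rpow_le_rpow (by positivity) ?_ h0
    -- Off the δ-ball, 1+|h| ≤ (1+δ⁻¹)|h|, which gives the comparison with (1+|h|)^(-r).
    have : 1 ≤ δ⁻¹ * ‖h‖ := by
      rw [inv_mul_eq_div, one_le_div hδ]; exact hh'.le
    linarith

theorem eucIntegrand_add {N : ℕ} (s : ℝ) (w : Euc N → ℝ) (x h : Euc N) :
    eucIntegrand s w x (x + h) = (w x - w (x + h)) * ‖h‖ ^ (-((N : ℝ) + 2 * s)) := by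
  rw [eucIntegrand, sub_add_cancel_left, norm_neg, Real.rpow_neg (norm_nonneg _), div_eq_mul_inv]

theorem measurable_eucIntegrand {N : ℕ} (s : ℝ) {w : Euc N → ℝ} (hw : Measurable w) (x : Euc N) :
    Measurable (eucIntegrand s w x) :=
  (measurable_const.sub hw).div ((measurable_const.sub measurable_id).norm.pow_const _)

theorem setIntegral_dist_eq {N : ℕ} (x : Euc N) (f : Euc N → ℝ) (δ : ℝ) :
    ∫ y in {y | δ < dist x y}, f y = ∫ h in {h : Euc N | δ < ‖h‖}, f (x + h) := by
  rw [← (measurePreserving_add_left volume x).setIntegral_preimage_emb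
    (measurableEmbedding_addLeft x)]
  congr 2
  ext h
  simp [dist_eq_norm]

theorem integrableOn_dist_iff {N : ℕ} (x : Euc N) (f : Euc N → ℝ) (δ : ℝ) :
    IntegrableOn f {y | δ < dist x y} ↔
      IntegrableOn (fun h => f (x + h)) {h : Euc N | δ < ‖h‖} := by
  rw [← (measurePreserving_add_left volume x).integrableOn_comp_preimage
    (measurableEmbedding_addLeft x)]
  have : (fun y => x + y) ⁻¹' {y | δ < dist x y} = {h : Euc N | δ < ‖h‖} := by
    ext h
    simp [dist_eq_norm]
  rw [this]
  rfl

theorem integrableOn_eucIntegrand {N : ℕ} {s δ M : ℝ} (hs : 0 < s) (hδ : 0 < δ) {w : Euc N → ℝ}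
    (hw : Measurable w) (hM : ∀ y, |w y| ≤ M) (x : Euc N) :
    IntegrableOn (eucIntegrand s w x) {y | δ < dist x y} := by
  rw [integrableOn_dist_iff]
  have h1 := (integrableOn_norm_rpow_neg (N := N) (r := (N : ℝ) + 2 * s) (by linarith) hδ).const_mul
    (2 * M)
  refine Integrable.mono' h1 ?_ (ae_of_all _ fun h => ?_)
  · exact ((measurable_eucIntegrand s hw x).comp
      (measurable_const_add x)).aestronglyMeasurable
  · rw [eucIntegrand_add, norm_mul, Real.norm_of_nonneg (Real.rpow_nonneg (norm_nonneg h) _)]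
    refine mul_le_mul_of_nonneg_right ?_ (Real.rpow_nonneg (norm_nonneg h) _)
    have h2 := hM x
    have h3 := hM (x + h)
    rw [Real.norm_eq_abs]
    rw [abs_le] at *
    constructor <;> linarith [h2.1, h2.2, h3.1, h3.2]

/-- The principal value of the fractional Laplacian of a bounded `C²` function exists. -/
theorem pvExists_eucIntegrand {N : ℕ} {s M : ℝ} (hN : N ≠ 0) (hs0 : 0 < s) (hs1 : s < 1)
    {w : Euc N → ℝ} (hw : ContDiff ℝ 2 w) (hM : ∀ y, |w y| ≤ M) (x : Euc N) :
    PVExists volume x (eucIntegrand s w x) := by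
  have hwm : Measurable w := hw.continuous.measurable
  have hint : ∀ δ : ℝ, 0 < δ → IntegrableOn (eucIntegrand s w x) {y | δ < dist x y} :=
    fun δ hδ => integrableOn_eucIntegrand hs0 hδ hwm hM x
  refine ⟨hint, ?_⟩
  obtain ⟨L, hL0, hL⟩ := exists_taylor_bound hw x
  set F : Euc N → ℝ := fun h => eucIntegrand s w x (x + h) with hF
  -- Averaging over h and -h preserves the truncated integrals and cancels the gradient term, so S
  -- is O(|h|^(2-N-2s)) near 0, integrable since s < 1.
  set S : Euc N → ℝ := fun h => (F h + F (-h)) / 2 with hS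
  have hFm : Measurable F := (measurable_eucIntegrand s hwm x).comp (measurable_const_add x)
  have hSm : Measurable S := (hFm.add (hFm.comp measurable_neg)).div_const 2
  have hFi : ∀ δ : ℝ, 0 < δ → IntegrableOn F {h | δ < ‖h‖} :=
    fun δ hδ => (integrableOn_dist_iff x _ δ).1 (hint δ hδ)
  have hneg : ∀ δ : ℝ, (fun h : Euc N => -h) ⁻¹' {h | δ < ‖h‖} = {h | δ < ‖h‖} := by
    intro δ; ext h; simp
  have hFi' : ∀ δ : ℝ, 0 < δ → IntegrableOn (fun h => F (-h)) {h | δ < ‖h‖} := by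
    intro δ hδ
    have := ((Measure.measurePreserving_neg (volume : Measure (Euc N))).integrableOn_comp_preimage
      (MeasurableEquiv.neg (Euc N)).measurableEmbedding (f := F) (s := {h | δ < ‖h‖})).2 (hFi δ hδ)
    rw [hneg] at this
    exact this
  have hsym : ∀ δ : ℝ, 0 < δ → truncInt volume x (eucIntegrand s w x) δ =
      ∫ h, ({h : Euc N | δ < ‖h‖}).indicator S h := by
    intro δ hδ
    have h1 : ∫ h in {h : Euc N | δ < ‖h‖}, F (-h) = ∫ h in {h : Euc N | δ < ‖h‖}, F h := by
      have := (Measure.measurePreserving_neg (volume : Measure (Euc N))).setIntegral_preimage_emb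
        (MeasurableEquiv.neg (Euc N)).measurableEmbedding F {h | δ < ‖h‖}
      rwa [hneg] at this
    rw [truncInt, setIntegral_dist_eq, integral_indicator
      (measurableSet_lt measurable_const measurable_norm), hS, integral_div,
      integral_add (hFi δ hδ) (hFi' δ hδ), h1]
    simp [hF]
  have hSball : IntegrableOn S (Metric.ball 0 1) := by
    refine integrableOn_ball_of_norm_le_rpow (C := L) (α := (N : ℝ) + 2 * s - 2)
      (by rw [finrank_euclideanSpace_fin]; omega)
      (by rw [finrank_euclideanSpace_fin]; linarith) ?_ hSm.aestronglyMeasurable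
    filter_upwards [self_mem_ae_restrict Metric.isOpen_ball.measurableSet,
      ae_restrict_of_ae (by
        have : Nontrivial (Euc N) := by
          have : Nonempty (Fin N) := Fin.pos_iff_nonempty.1 (Nat.pos_of_ne_zero hN)
          infer_instance
        exact Measure.ae_ne volume (0 : Euc N))] with h hh h0
    have hh1 : ‖h‖ ≤ 1 := by
      have : ‖h‖ < 1 := by simpa using hh
      exact this.le
    have hpos : 0 < ‖h‖ := norm_pos_iff.2 h0
    have e1 := hL h hh1
    have e2 := hL (-h) (by simpa using hh1)
    rw [map_neg, norm_neg] at e2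
    have e3 : S h = -((w (x + h) - w x - fderiv ℝ w x h) +
        (w (x + -h) - w x - -(fderiv ℝ w x h))) / 2 * ‖h‖ ^ (-((N : ℝ) + 2 * s)) := by
      simp only [hS, hF]
      rw [eucIntegrand_add, eucIntegrand_add, norm_neg]
      ring
    rw [e3, norm_mul, Real.norm_of_nonneg (Real.rpow_nonneg (norm_nonneg h) _),
      show -((N : ℝ) + 2 * s - 2) = -((N : ℝ) + 2 * s) + (2 : ℕ) by push_cast; ring,
      Real.rpow_add_natCast hpos.ne', mul_comm (‖h‖ ^ (-((N : ℝ) + 2 * s))), ← mul_assoc]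
    refine mul_le_mul_of_nonneg_right ?_ (Real.rpow_nonneg (norm_nonneg h) _)
    rw [Real.norm_eq_abs]
    rw [abs_le] at *
    constructor <;> linarith [e1.1, e1.2, e2.1, e2.2]
  have hSi : Integrable S := by
    rw [← integrableOn_univ]
    -- The exterior region starts at radius 1/2 so that it overlaps the open unit ball and covers
    -- the unit sphere.
    refine (hSball.union (((hFi (1 / 2) (by norm_num)).add
      (hFi' (1 / 2) (by norm_num))).div_const 2)).mono_set fun h _ => ?_
    by_cases hh : ‖h‖ < 1
    · left; simpa using hh
    · right
      have : (1 / 2 : ℝ) < ‖h‖ := by linarith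
      exact this
  refine ⟨∫ h, S h, ?_⟩
  have hlim : Tendsto (fun δ : ℝ => ∫ h, ({h : Euc N | δ < ‖h‖}).indicator S h) (𝓝[>] 0)
      (𝓝 (∫ h, S h)) := by
    refine tendsto_integral_filter_of_dominated_convergence (fun h => ‖S h‖) ?_ ?_ hSi.norm ?_
    · exact Eventually.of_forall fun δ => (hSm.indicator
        (measurableSet_lt measurable_const measurable_norm)).aestronglyMeasurable
    · exact Eventually.of_forall fun δ => ae_of_all _ fun h => norm_indicator_le_norm_self S h
    · refine ae_of_all _ fun h => ?_
      by_cases h0 : h = 0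
      · have : S h = 0 := by simp [hS, hF, eucIntegrand, h0]
        rw [this]
        refine tendsto_const_nhds.congr fun δ => ?_
        by_cases hm : h ∈ {h : Euc N | δ < ‖h‖}
        · rw [Set.indicator_of_mem hm, this]
        · rw [Set.indicator_of_notMem hm]
      · refine tendsto_const_nhds.congr' ?_
        filter_upwards [nhdsWithin_le_nhds (Iio_mem_nhds (norm_pos_iff.2 h0))] with δ hδ
        exact (Set.indicator_of_mem (s := {h : Euc N | δ < ‖h‖}) hδ S).symm
  refine hlim.congr' ?_
  filter_upwards [self_mem_nhdsWithin] with δ hδ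
  exact (hsym δ hδ).symm

/-! ### Shell estimates -/

theorem volume_real_ball {N : ℕ} (hN : N ≠ 0) (x : Euc N) {R : ℝ} (hR : 0 ≤ R) :
    volume.real (Metric.ball x R) = R ^ N * volume.real (Metric.ball (0 : Euc N) 1) := by
  have : Nontrivial (Euc N) := by
    have : Nonempty (Fin N) := Fin.pos_iff_nonempty.1 (Nat.pos_of_ne_zero hN)
    infer_instance
  rw [measureReal_def, Measure.addHaar_ball _ _ hR, ENNReal.toReal_mul,
    ENNReal.toReal_ofReal (by positivity), finrank_euclideanSpace_fin, measureReal_def]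

theorem volume_real_shell_le {N : ℕ} (hN : N ≠ 0) {R B : ℝ} (hB : 0 ≤ B) (hBR : B ≤ R) :
    volume.real (Metric.ball (0 : Euc N) (R + B) \ Metric.ball 0 (R - B)) ≤
      2 * B * N * (2 * R) ^ (N - 1) * volume.real (Metric.ball (0 : Euc N) 1) := by
  rw [measureReal_sdiff (Metric.ball_subset_ball (by linarith)) Metric.isOpen_ball.measurableSet
      measure_ball_lt_top.ne, volume_real_ball hN _ (by linarith : 0 ≤ R + B),
    volume_real_ball hN _ (by linarith : 0 ≤ R - B), ← sub_mul]
  refine mul_le_mul_of_nonneg_right ?_ measureReal_nonneg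
  have h := (le_abs_self _).trans (abs_pow_sub_pow_le (R + B) (R - B) N)
  refine h.trans ?_
  rw [show R + B - (R - B) = 2 * B by ring, abs_of_nonneg (by linarith : (0 : ℝ) ≤ 2 * B),
    abs_of_nonneg (by linarith : (0 : ℝ) ≤ R + B), abs_of_nonneg (by linarith : (0 : ℝ) ≤ R - B),
    max_eq_left (by linarith)]
  exact mul_le_mul_of_nonneg_left (pow_le_pow_left₀ (by linarith) (by linarith) _) (by positivity)

/-- Moving the centre of a ball changes an integral only by the contribution of a shell. -/
theorem abs_setIntegral_ball_sub_le {N : ℕ} {b : Euc N} {R M : ℝ} {h : Euc N → ℝ} (hM0 : 0 ≤ M)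
    (hM : ∀ η, R - ‖b‖ ≤ ‖η‖ → ‖η‖ ≤ R + ‖b‖ → |h η| ≤ M)
    (hb : IntegrableOn h (Metric.ball b R)) (h0 : IntegrableOn h (Metric.ball 0 R)) :
    |(∫ η in Metric.ball b R, h η) - ∫ η in Metric.ball 0 R, h η| ≤
      2 * (M * volume.real (Metric.ball (0 : Euc N) (R + ‖b‖) \ Metric.ball 0 (R - ‖b‖))) := by
  have hmeas : ∀ c : Euc N, MeasurableSet (Metric.ball c R) :=
    fun c => Metric.isOpen_ball.measurableSet
  -- The common intersection cancels; each of the two set differences lies in the shell, hence the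
  -- factor 2.
  have e1 := integral_inter_add_sdiff (hmeas 0) hb
  have e2 := integral_inter_add_sdiff (hmeas b) h0
  rw [Set.inter_comm] at e2
  set A := Metric.ball (0 : Euc N) (R + ‖b‖) \ Metric.ball 0 (R - ‖b‖) with hA
  have hAfin : volume A ≠ ⊤ := ((measure_mono Set.sdiff_subset).trans_lt measure_ball_lt_top).ne
  have sub1 : Metric.ball b R \ Metric.ball 0 R ⊆ A := by
    rintro η ⟨h1, h2⟩
    simp only [Metric.mem_ball, dist_eq_norm, sub_zero, not_lt] at h1 h2
    have h3 := norm_sub_norm_le η b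
    simp only [hA, Set.mem_sdiff, Metric.mem_ball, dist_zero_right, not_lt]
    exact ⟨by linarith, by linarith [norm_nonneg b]⟩
  have sub2 : Metric.ball 0 R \ Metric.ball b R ⊆ A := by
    rintro η ⟨h1, h2⟩
    simp only [Metric.mem_ball, dist_eq_norm, sub_zero, not_lt] at h1 h2
    have h3 := norm_sub_le η b
    simp only [hA, Set.mem_sdiff, Metric.mem_ball, dist_zero_right, not_lt]
    exact ⟨by linarith [norm_nonneg b], by linarith⟩
  have bound : ∀ D ⊆ A, |∫ η in D, h η| ≤ M * volume.real A := by
    intro D hD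
    have h1 := norm_setIntegral_le_of_norm_le_const (μ := volume) (s := D) (f := h) (C := M)
      ((measure_mono hD).trans_lt hAfin.lt_top) (fun η hη => by
        have := hD hη
        simp only [hA, Set.mem_sdiff, Metric.mem_ball, dist_zero_right, not_lt] at this
        exact hM η this.2 this.1.le)
    exact h1.trans (mul_le_mul_of_nonneg_left (measureReal_mono hD hAfin) hM0)
  have b1 := bound _ sub1
  have b2 := bound _ sub2
  rw [abs_le] at *
  constructor <;> linarith [b1.1, b1.2, b2.1, b2.2]

/-- The shell has volume O(R^(N-1)), so the difference is O(R^(-(2-2s))). The integrand may depend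
on R so that a constant can be subtracted for each R. -/
theorem tendsto_shell {N : ℕ} (hN : N ≠ 0) {s K R₀ : ℝ} (hs1 : s < 1)
    (hK0 : 0 ≤ K) (b : Euc N) {h : ℝ → Euc N → ℝ}
    (hb : ∀ R, R₀ ≤ R → IntegrableOn (h R) (Metric.ball b R))
    (h0 : ∀ R, R₀ ≤ R → IntegrableOn (h R) (Metric.ball 0 R))
    (hK : ∀ R η, R₀ ≤ R → R / 2 ≤ ‖η‖ → |‖η‖ - R| ≤ ‖b‖ →
      |h R η| ≤ K * R ^ (-((N : ℝ) - 2 * s) - 1)) :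
    Tendsto (fun R => (∫ η in Metric.ball b R, h R η) - ∫ η in Metric.ball 0 R, h R η)
      atTop (𝓝 0) := by
  set D : ℝ := 2 * (K * (2 * ‖b‖ * N * 2 ^ (N - 1) * volume.real (Metric.ball (0 : Euc N) 1)))
    with hD
  have hlim : Tendsto (fun R : ℝ => D * R ^ (-(2 - 2 * s))) atTop (𝓝 0) := by
    simpa using (tendsto_rpow_neg_atTop (by linarith : (0 : ℝ) < 2 - 2 * s)).const_mul D
  refine squeeze_zero_norm' ?_ hlim
  filter_upwards [eventually_ge_atTop R₀, eventually_ge_atTop (2 * ‖b‖), eventually_gt_atTop 0]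
    with R h1 h2 h3
  have h4 := abs_setIntegral_ball_sub_le (b := b) (R := R)
    (mul_nonneg hK0 (Real.rpow_pos_of_pos h3 (-((N : ℝ) - 2 * s) - 1)).le)
    (fun η e1 e2 => hK R η h1 (by linarith)
      (abs_le.2 ⟨by linarith, by linarith⟩)) (hb R h1) (h0 R h1)
  refine h4.trans ?_
  have hpow : 0 < R ^ (-((N : ℝ) - 2 * s) - 1) := Real.rpow_pos_of_pos h3 _
  have h5 := volume_real_shell_le (N := N) hN (norm_nonneg b)
    (by linarith [norm_nonneg b] : ‖b‖ ≤ R)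
  have h6 : R ^ (-((N : ℝ) - 2 * s) - 1) * R ^ (N - 1) = R ^ (-(2 - 2 * s)) := by
    rw [← Real.rpow_natCast, ← Real.rpow_add h3, Nat.cast_sub (Nat.one_le_iff_ne_zero.2 hN)]
    congr 1
    push_cast
    ring
  calc 2 * (K * R ^ (-((N : ℝ) - 2 * s) - 1) * volume.real (Metric.ball (0 : Euc N) (R + ‖b‖) \
        Metric.ball 0 (R - ‖b‖)))
      ≤ 2 * (K * R ^ (-((N : ℝ) - 2 * s) - 1) * (2 * ‖b‖ * N * (2 * R) ^ (N - 1) *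
        volume.real (Metric.ball (0 : Euc N) 1))) := by gcongr
    _ = D * (R ^ (-((N : ℝ) - 2 * s) - 1) * R ^ (N - 1)) := by
        rw [hD, mul_pow]; ring
    _ = D * R ^ (-(2 - 2 * s)) := by rw [h6]

/-- The bubble profile `(|η|² + k²)^(-a)` varies by `O(R^(-2a-1))` on shells of fixed width. -/
theorem abs_profile_sub_le {a k B R t : ℝ} (ha : 0 < a) (hR : 0 < R)
    (h1 : R / 2 ≤ t) (h2 : |t - R| ≤ B) :
    |(t ^ 2 + k ^ 2) ^ (-a) - (R ^ 2 + k ^ 2) ^ (-a)| ≤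
      2 * a * B * (R / 2) ^ (-(2 * a) - 1) := by
  have hd : ∀ r ∈ Set.Ici (R / 2), HasDerivWithinAt (fun r => (r ^ 2 + k ^ 2) ^ (-a))
      (2 * r * (-a) * (r ^ 2 + k ^ 2) ^ (-a - 1)) (Set.Ici (R / 2)) r := by
    intro r hr
    have hr0 : 0 < r := lt_of_lt_of_le (by linarith) (Set.mem_Ici.1 hr)
    have h3 := (((hasDerivAt_id r).pow 2).add_const (k ^ 2)).rpow_const (p := -a)
      (Or.inl (by simp only [Pi.pow_apply, id]; positivity))
    refine (h3.congr_deriv ?_).hasDerivWithinAt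
    simp
  have hbd : ∀ r ∈ Set.Ici (R / 2), ‖2 * r * (-a) * (r ^ 2 + k ^ 2) ^ (-a - 1)‖ ≤
      2 * a * (R / 2) ^ (-(2 * a) - 1) := by
    intro r hr
    have hr' := Set.mem_Ici.1 hr
    have hr0 : 0 < r := lt_of_lt_of_le (by linarith) hr'
    have e0 : 0 ≤ (r ^ 2 + k ^ 2) ^ (-a - 1) := Real.rpow_nonneg (by positivity) _
    rw [show 2 * r * (-a) * (r ^ 2 + k ^ 2) ^ (-a - 1) =
      -(2 * a * (r * (r ^ 2 + k ^ 2) ^ (-a - 1))) by ring, norm_neg,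
      Real.norm_of_nonneg (by positivity)]
    refine mul_le_mul_of_nonneg_left ?_ (by positivity)
    calc r * (r ^ 2 + k ^ 2) ^ (-a - 1) ≤ r * (r ^ 2) ^ (-a - 1) := by
          refine mul_le_mul_of_nonneg_left ?_ hr0.le
          exact Real.rpow_le_rpow_of_nonpos (by positivity) (by nlinarith [sq_nonneg k])
            (by linarith)
      _ = r ^ (-(2 * a) - 1) := by
          rw [← Real.rpow_natCast r 2, ← Real.rpow_mul hr0.le, ← Real.rpow_one_add' hr0.le]
          · congr 1
            push_cast
            ring
          · push_cast
            linarith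
      _ ≤ _ := Real.rpow_le_rpow_of_nonpos (by positivity) hr' (by linarith)
  have h3 := (convex_Ici (R / 2)).norm_image_sub_le_of_norm_hasDerivWithin_le hd hbd
    (x := R) (y := t) (Set.mem_Ici.2 (by linarith)) (Set.mem_Ici.2 h1)
  rw [Real.norm_eq_abs, Real.norm_eq_abs] at h3
  refine h3.trans ?_
  have : 0 ≤ 2 * a * (R / 2) ^ (-(2 * a) - 1) := by positivity
  nlinarith

/-! ### The bubble equation -/

/-- The Jacobian |η|^(-2N) meets the kernel |η|^(N+2s), leaving |η|^(-(N-2s)). -/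
theorem invPull_eucIntegrand {N : ℕ} (s : ℝ) (w : Euc N → ℝ) (x : Euc N) {η : Euc N}
    (hη : η ≠ 0) :
    invPull x (eucIntegrand s w x) η =
      (w x - w (invMap x η)) * (‖η‖ ^ 2) ^ (-(((N : ℝ) - 2 * s) / 2)) := by
  have h0 : 0 < ‖η‖ := norm_pos_iff.2 hη
  rw [invPull, eucIntegrand, norm_sub_invMap, Real.inv_rpow h0.le, div_inv_eq_mul, mul_left_comm]
  congr 1
  rw [← Real.rpow_natCast ‖η‖ 2, ← Real.rpow_neg h0.le, ← Real.rpow_natCast, ← Real.rpow_mul h0.le,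
    ← Real.rpow_add h0, ← Real.rpow_mul h0.le]
  congr 1
  push_cast
  ring

/-- By `confFactor_invMap`, the value of ψ_s at the inverted point carries a factor |η|^(N-2s),
which cancels the weight. -/
theorem invPull_eucIntegrand_psi {N : ℕ} (s : ℝ) (x : Euc N) {η : Euc N} (hη : η ≠ 0) :
    invPull x (eucIntegrand s (psi s) x) η = confFactor x ^ (((N : ℝ) - 2 * s) / 2) *
      ((‖η‖ ^ 2) ^ (-(((N : ℝ) - 2 * s) / 2)) -
        (‖η + (confFactor x / 2) • x‖ ^ 2 + (confFactor x / 2) ^ 2) ^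
          (-(((N : ℝ) - 2 * s) / 2))) := by
  have h0 : 0 < ‖η‖ := norm_pos_iff.2 hη
  have hJ := confFactor_pos x
  rw [invPull_eucIntegrand s _ x hη, psi_eq_confFactor, psi_eq_confFactor,
    confFactor_invMap x hη, Real.div_rpow (by positivity) (by positivity),
    Real.mul_rpow hJ.le (by positivity), Real.rpow_neg (by positivity),
    Real.rpow_neg (by positivity)]
  have h1 : 0 < (‖η‖ ^ 2) ^ (((N : ℝ) - 2 * s) / 2) := Real.rpow_pos_of_pos (by positivity) _
  have h2 : 0 < (‖η + (confFactor x / 2) • x‖ ^ 2 + (confFactor x / 2) ^ 2) ^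
    (((N : ℝ) - 2 * s) / 2) := Real.rpow_pos_of_pos (by positivity) _
  field_simp

theorem ball_sdiff_ae_eq {N : ℕ} (hN : N ≠ 0) (c : Euc N) (R : ℝ) :
    (Metric.ball c R \ {0} : Set (Euc N)) =ᵐ[volume] Metric.ball c R := by
  have : Nontrivial (Euc N) := by
    have : Nonempty (Fin N) := Fin.pos_iff_nonempty.1 (Nat.pos_of_ne_zero hN)
    infer_instance
  exact sdiff_null_ae_eq_self (measure_singleton _)

theorem truncInt_eq_invPull {N : ℕ} (hN : N ≠ 0) (x : Euc N) (f : Euc N → ℝ) {R : ℝ}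
    (hR : 0 < R) :
    (truncInt volume x f R⁻¹ = ∫ η in Metric.ball 0 R, invPull x f η) ∧
      (IntegrableOn f {y | R⁻¹ < dist x y} ↔
        IntegrableOn (invPull x f) (Metric.ball 0 R)) := by
  have h := setIntegral_eq_invPull (x := x) (P := {y | R⁻¹ < dist x y})
    (measurableSet_lt measurable_const (measurable_const.dist measurable_id))
    (by simp [hR.le]) f
  rw [preimage_invMap_dist x hR, setIntegral_congr_set (ball_sdiff_ae_eq hN 0 R),
    integrableOn_congr_set_ae (ball_sdiff_ae_eq hN 0 R)] at h
  exact h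

theorem continuous_profile {N : ℕ} {k : ℝ} (hk : k ≠ 0) (p : ℝ) :
    Continuous fun η : Euc N => (‖η‖ ^ 2 + k ^ 2) ^ p :=
  Continuous.rpow_const (by fun_prop) fun η => Or.inl (by positivity)

/-- Translating the bubble profile does not change its integral over large balls in the limit. -/
theorem tendsto_profile_shift {N : ℕ} (hN : N ≠ 0) {s k : ℝ} (hs1 : s < 1)
    (hsN : 2 * s < (N : ℝ)) (hk : 0 < k) (b : Euc N) :
    Tendsto (fun R => (∫ η in Metric.ball (0 : Euc N) R,
        (‖η + b‖ ^ 2 + k ^ 2) ^ (-(((N : ℝ) - 2 * s) / 2))) -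
      ∫ η in Metric.ball (0 : Euc N) R, (‖η‖ ^ 2 + k ^ 2) ^ (-(((N : ℝ) - 2 * s) / 2)))
      atTop (𝓝 0) := by
  set a : ℝ := ((N : ℝ) - 2 * s) / 2 with ha
  have ha0 : 0 < a := by rw [ha]; linarith
  set g : Euc N → ℝ := fun η => (‖η‖ ^ 2 + k ^ 2) ^ (-a) with hg
  have hgc : Continuous g := continuous_profile hk.ne' _
  have hgi : ∀ (c : Euc N) (R : ℝ), IntegrableOn g (Metric.ball c R) := fun c R =>
    (hgc.continuousOn.integrableOn_compact (isCompact_closedBall c R)).mono_set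
      Metric.ball_subset_closedBall
  have hci : ∀ (c : Euc N) (R : ℝ) (t : ℝ), IntegrableOn (fun _ => t) (Metric.ball c R) :=
    fun c R t => integrableOn_const measure_ball_lt_top.ne
  -- The profile alone is only O(R^(-2a)) on the shell, too large when s ≥ 1/2. Subtracting its
  -- value at radius R gains a factor 1/R and changes nothing, since both balls have the same
  -- volume.
  have h := tendsto_shell (s := s) (R₀ := 1)
    (K := 2 * a * ‖b‖ * (2⁻¹) ^ (-(2 * a) - 1)) hN hs1 (by positivity) b
    (h := fun R η => g η - (R ^ 2 + k ^ 2) ^ (-a))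
    (fun R _ => (hgi _ _).sub (hci _ _ _)) (fun R _ => (hgi _ _).sub (hci _ _ _))
    (fun R η hR h1 h2 => by
      have hR0 : 0 < R := by linarith
      have h3 := abs_profile_sub_le (k := k) ha0 hR0 h1 h2
      rw [div_eq_mul_inv, Real.mul_rpow hR0.le (by norm_num)] at h3
      refine h3.trans (le_of_eq ?_)
      rw [show -((N : ℝ) - 2 * s) - 1 = -(2 * a) - 1 by rw [ha]; ring]
      ring)
  refine h.congr fun R => ?_
  have h4 : ∫ η in Metric.ball (0 : Euc N) R, (‖η + b‖ ^ 2 + k ^ 2) ^ (-a) =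
      ∫ η in Metric.ball b R, g η := by
    have h5 := (measurePreserving_add_right volume b).setIntegral_preimage_emb
      (measurableEmbedding_addRight b) g (Metric.ball b R)
    have h6 : (fun η => η + b) ⁻¹' Metric.ball b R = Metric.ball (0 : Euc N) R := by
      ext η
      simp [dist_eq_norm]
    rwa [h6] at h5
  rw [h4, integral_sub (hgi _ _) (hci _ _ _), integral_sub (hgi _ _) (hci _ _ _),
    setIntegral_const, setIntegral_const, Measure.addHaar_real_ball_center volume b]
  simp only [hg]
  ring

/-- `∫ (|η|^(-2a) - (|η|²+k²)^(-a)) dη` for `a = (N - 2s)/2`, as a Bochner integral. -/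
theorem integral_norm_rpow_sub {N : ℕ} {s k : ℝ} (hs0 : 0 < s) (hs1 : s < 1)
    (hsN : 2 * s < (N : ℝ)) (hk : 0 < k) :
    Integrable (fun x : Euc N => (‖x‖ ^ 2) ^ (-(((N : ℝ) - 2 * s) / 2)) -
        (‖x‖ ^ 2 + k ^ 2) ^ (-(((N : ℝ) - 2 * s) / 2))) ∧
    ∫ x : Euc N, ((‖x‖ ^ 2) ^ (-(((N : ℝ) - 2 * s) / 2)) -
        (‖x‖ ^ 2 + k ^ 2) ^ (-(((N : ℝ) - 2 * s) / 2))) =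
      Real.pi ^ ((N : ℝ) / 2) * Real.Gamma (1 - s) /
        (s * Real.Gamma ((N : ℝ) / 2 - s)) * (k ^ 2) ^ s := by
  have h := lintegral_norm_rpow_sub hs0 hs1 hsN hk
  have hN : N ≠ 0 := by
    rintro rfl
    norm_num at hsN
    linarith
  have : Nontrivial (Euc N) := by
    have : Nonempty (Fin N) := Fin.pos_iff_nonempty.1 (Nat.pos_of_ne_zero hN)
    infer_instance
  set a : ℝ := ((N : ℝ) - 2 * s) / 2 with ha
  have ha0 : 0 < a := by rw [ha]; linarith
  have hm : AEStronglyMeasurable (fun x : Euc N => (‖x‖ ^ 2) ^ (-a) -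
      (‖x‖ ^ 2 + k ^ 2) ^ (-a)) volume :=
    Measurable.aestronglyMeasurable (by fun_prop)
  have hnn : 0 ≤ᵐ[volume] fun x : Euc N => (‖x‖ ^ 2) ^ (-a) - (‖x‖ ^ 2 + k ^ 2) ^ (-a) := by
    filter_upwards [Measure.ae_ne volume (0 : Euc N)] with x hx
    have : 0 < ‖x‖ := norm_pos_iff.2 hx
    exact sub_nonneg.2 (Real.rpow_le_rpow_of_nonpos (by positivity)
      (by linarith [sq_nonneg k]) (by linarith))
  have hG1 : 0 < Real.Gamma (1 - s) := Real.Gamma_pos_of_pos (by linarith)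
  have hG2 : 0 < Real.Gamma ((N : ℝ) / 2 - s) := Real.Gamma_pos_of_pos (by linarith)
  refine ⟨⟨hm, ?_⟩, ?_⟩
  · rw [hasFiniteIntegral_iff_ofReal hnn, h]
    exact ENNReal.ofReal_lt_top
  · rw [integral_eq_lintegral_of_nonneg_ae hnn hm, h, ENNReal.toReal_ofReal (by positivity)]

theorem tendsto_setIntegral_ball {N : ℕ} {f : Euc N → ℝ} (hf : Integrable f) :
    Tendsto (fun R : ℝ => ∫ η in Metric.ball (0 : Euc N) R, f η) atTop (𝓝 (∫ η, f η)) := by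
  have h := tendsto_setIntegral_of_monotone (μ := volume) (f := f)
    (s := fun R : ℝ => Metric.ball (0 : Euc N) R) (fun _ => Metric.isOpen_ball.measurableSet)
    (fun _ _ h => Metric.ball_subset_ball h) hf.integrableOn
  have hU : ⋃ R : ℝ, Metric.ball (0 : Euc N) R = Set.univ := by
    refine Set.eq_univ_of_forall fun η => Set.mem_iUnion.2 ⟨‖η‖ + 1, ?_⟩
    simp
  rwa [hU, setIntegral_univ] at h

theorem tendsto_truncInt_inv {N : ℕ} {x : Euc N} {f : Euc N → ℝ} {L : ℝ}
    (h : Tendsto (truncInt volume x f) (𝓝[>] 0) (𝓝 L)) :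
    Tendsto (fun R : ℝ => truncInt volume x f R⁻¹) atTop (𝓝 L) :=
  h.comp tendsto_inv_atTop_nhdsGT_zero

/-- The principal value of the fractional Laplacian of the bubble `ψ_s`. -/
theorem tendsto_truncInt_psi {N : ℕ} {s : ℝ} (hs0 : 0 < s) (hs1 : s < 1)
    (hsN : 2 * s < (N : ℝ)) (x : Euc N) :
    Tendsto (truncInt volume x (eucIntegrand s (psi s) x)) (𝓝[>] 0)
      (𝓝 (confFactor x ^ (((N : ℝ) - 2 * s) / 2) * (Real.pi ^ ((N : ℝ) / 2) * Real.Gamma (1 - s) /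
        (s * Real.Gamma ((N : ℝ) / 2 - s)) * ((confFactor x / 2) ^ 2) ^ s))) := by
  have hN : N ≠ 0 := by
    rintro rfl
    norm_num at hsN
    linarith
  obtain ⟨-, L, hL⟩ := pvExists_eucIntegrand hN hs0 hs1
    (contDiff_infty.1 (contDiff_psi N s) 2)
    (fun y => by rw [abs_of_pos (psi_pos s y)]; exact psi_le hsN y) x
  have hL' := tendsto_truncInt_inv hL
  have hk : 0 < confFactor x / 2 := by linarith [confFactor_pos x]
  obtain ⟨hi, hval⟩ := integral_norm_rpow_sub hs0 hs1 hsN hk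
  have h1 := tendsto_setIntegral_ball hi
  have h2 := tendsto_profile_shift hN hs1 hsN hk ((confFactor x / 2) • x)
  rw [hval] at h1
  have h3 := (h1.sub h2).const_mul (confFactor x ^ (((N : ℝ) - 2 * s) / 2))
  rw [sub_zero] at h3
  -- The limit is known to exist; its value is identified along ε = 1/R.
  rw [← tendsto_nhds_unique hL' (h3.congr' ?_)]
  · exact hL
  filter_upwards [eventually_gt_atTop 0] with R hR
  rw [(truncInt_eq_invPull hN x _ hR).1]
  have hcont : ∀ {f : Euc N → ℝ}, Continuous f → IntegrableOn f (Metric.ball 0 R) := fun hf =>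
    (hf.continuousOn.integrableOn_compact (isCompact_closedBall 0 R)).mono_set
      Metric.ball_subset_closedBall
  have hg1 := hcont (continuous_profile (N := N) hk.ne' (-(((N : ℝ) - 2 * s) / 2)))
  have hg2 : IntegrableOn (fun η : Euc N => (‖η + (confFactor x / 2) • x‖ ^ 2 +
      (confFactor x / 2) ^ 2) ^ (-(((N : ℝ) - 2 * s) / 2))) (Metric.ball 0 R) :=
    hcont ((continuous_profile (N := N) hk.ne' (-(((N : ℝ) - 2 * s) / 2))).comp
      (continuous_add_const ((confFactor x / 2) • x)))
  have hg21 : IntegrableOn (fun η : Euc N => (‖η + (confFactor x / 2) • x‖ ^ 2 +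
      (confFactor x / 2) ^ 2) ^ (-(((N : ℝ) - 2 * s) / 2)) -
      (‖η‖ ^ 2 + (confFactor x / 2) ^ 2) ^ (-(((N : ℝ) - 2 * s) / 2))) (Metric.ball 0 R) :=
    hg2.sub hg1
  rw [← integral_sub hg2 hg1, ← integral_sub hi.integrableOn hg21, ← integral_const_mul,
    ← setIntegral_congr_set (ball_sdiff_ae_eq hN 0 R),
    ← setIntegral_congr_set (ball_sdiff_ae_eq hN 0 R)]
  refine setIntegral_congr_fun (Metric.isOpen_ball.measurableSet.diff
    (measurableSet_singleton _)) fun η hη => ?_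
  simp only [invPull_eucIntegrand_psi s x hη.2]
  ring

/-- The constants in the bubble equation `(-Δ)^s ψ_s = A_{N,s} ψ_s^((N+2s)/(N-2s))`. -/
theorem cConst_mul_bubble {N : ℕ} {s J : ℝ} (hs0 : 0 < s) (hs1 : s < 1)
    (hsN : 2 * s < (N : ℝ)) (hJ : 0 < J) :
    cConst N s * (J ^ (((N : ℝ) - 2 * s) / 2) * (Real.pi ^ ((N : ℝ) / 2) * Real.Gamma (1 - s) /
      (s * Real.Gamma ((N : ℝ) / 2 - s)) * ((J / 2) ^ 2) ^ s)) =
      AConst N s * J ^ (((N : ℝ) + 2 * s) / 2) := by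
  have hG1 : 0 < Real.Gamma (1 - s) := Real.Gamma_pos_of_pos (by linarith)
  have hG2 : 0 < Real.Gamma ((N : ℝ) / 2 - s) := Real.Gamma_pos_of_pos (by linarith)
  -- The factor s(1-s)/Γ(2-s) of c_{N,s} thus absorbs Γ(1-s)/s, and 4^s absorbs the halving of J.
  have e1 : Real.Gamma (2 - s) = (1 - s) * Real.Gamma (1 - s) := by
    rw [← Real.Gamma_add_one (by linarith)]
    congr 1
    ring
  have e2 : ((J / 2) ^ 2) ^ s = J ^ (2 * s) / 4 ^ s := by
    rw [div_pow, Real.div_rpow (by positivity) (by positivity), ← Real.rpow_natCast J 2,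
      ← Real.rpow_mul hJ.le]
    norm_num
  have e3 : J ^ (((N : ℝ) + 2 * s) / 2) = J ^ (((N : ℝ) - 2 * s) / 2) * J ^ (2 * s) := by
    rw [← Real.rpow_add hJ]
    congr 1
    ring
  have h4 : (0 : ℝ) < 4 ^ s := by positivity
  have hpi : 0 < Real.pi ^ ((N : ℝ) / 2) := Real.rpow_pos_of_pos Real.pi_pos _
  have hs1' : 1 - s ≠ 0 := by linarith
  rw [cConst, AConst, e1, e2, e3, Real.rpow_neg Real.pi_pos.le]
  field_simp

/-! ### Transfer from the sphere to ℝ^N -/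

/-- Truncated integrals on the sphere in stereographic coordinates. -/
theorem truncInt_sphVol {N : ℕ} (hN : N ≠ 0) (x : Euc N) (f : Sph N → ℝ) (ε : ℝ) :
    truncInt (sphVol N) (stereoInv x) f ε =
      ∫ y in {y | ε < dist (stereoInv x) (stereoInv y)}, confFactor y ^ N * f (stereoInv y) := by
  have hm : MeasurableSet {y : Euc N | ε < dist (stereoInv x) (stereoInv y)} :=
    measurableSet_lt measurable_const (measurable_const.dist (continuous_stereoInv N).measurable)
  rw [truncInt, sphVol_eq_map hN, (measurableEmbedding_stereoInv N).setIntegral_map]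
  change ∫ y in {y | ε < dist (stereoInv x) (stereoInv y)}, f (stereoInv y)
    ∂(volume.withDensity fun y => ENNReal.ofReal (confFactor y ^ N)) = _
  have hJ : Measurable fun y : Euc N => Real.toNNReal (confFactor y ^ N) :=
    ((continuous_confFactor N).measurable.pow_const N).real_toNNReal
  have h := setIntegral_withDensity_eq_setIntegral_smul (μ := volume) hJ
    (fun y => f (stereoInv y)) hm
  refine h.trans (setIntegral_congr_fun hm fun y _ => ?_)
  have := confFactor_pos y
  simp only [NNReal.smul_def, smul_eq_mul, Real.coe_toNNReal _ (pow_nonneg this.le N)]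

/-- The conformal covariance of the singular integrand. -/
theorem confFactor_pow_mul_sphIntegrand {N : ℕ} (s : ℝ) (u : Sph N → ℝ) (x y : Euc N) :
    confFactor y ^ N * sphIntegrand s u (stereoInv x) (stereoInv y) =
      confFactor x ^ (-(((N : ℝ) + 2 * s) / 2)) *
        (eucIntegrand s (fun y => psi s y * u (stereoInv y)) x y -
          u (stereoInv x) * eucIntegrand s (psi s) x y) := by
  have hx := confFactor_pos x
  have hy := confFactor_pos y
  -- Of the density J(y)^N, one part is ψ_s(y); the other cancels the J(y) in the chordal kernel.
  have e1 : confFactor y ^ N = psi s y * confFactor y ^ (((N : ℝ) + 2 * s) / 2) := by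
    rw [psi_eq_confFactor, ← Real.rpow_add hy, ← Real.rpow_natCast]
    congr 1
    ring
  rw [sphIntegrand, eucIntegrand, eucIntegrand, norm_stereoInv_sub, e1,
    Real.mul_rpow (by positivity) (norm_nonneg _), ← Real.rpow_mul (by positivity),
    Real.mul_rpow hx.le hy.le, Real.rpow_neg hx.le,
    show 1 / 2 * ((N : ℝ) + 2 * s) = ((N : ℝ) + 2 * s) / 2 by ring]
  have h1 : 0 < confFactor x ^ (((N : ℝ) + 2 * s) / 2) := Real.rpow_pos_of_pos hx _
  have h2 : 0 < confFactor y ^ (((N : ℝ) + 2 * s) / 2) := Real.rpow_pos_of_pos hy _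
  rcases eq_or_ne x y with rfl | hxy
  · simp
  · have h3 : 0 < ‖x - y‖ ^ ((N : ℝ) + 2 * s) :=
      Real.rpow_pos_of_pos (norm_pos_iff.2 (sub_ne_zero.2 hxy)) _
    field_simp
    ring

/-- Chordal truncations and Euclidean truncations have the same limit. -/
theorem tendsto_chordal_trunc {N : ℕ} (hN : N ≠ 0) {s K L : ℝ} (hs1 : s < 1)
    (hsN : 2 * s < (N : ℝ)) (x : Euc N)
    {G : Euc N → ℝ} (hK0 : 0 ≤ K)
    (hK : ∀ y, ‖x - y‖ ≤ 1 → |G y| ≤ K * ‖x - y‖ / ‖x - y‖ ^ ((N : ℝ) + 2 * s))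
    (hGi : ∀ δ, 0 < δ → IntegrableOn G {y | δ < dist x y})
    (hG : Tendsto (truncInt volume x G) (𝓝[>] 0) (𝓝 L)) :
    Tendsto (fun ε => ∫ y in {y | ε < dist (stereoInv x) (stereoInv y)}, G y) (𝓝[>] 0)
      (𝓝 L) := by
  set J := confFactor x with hJdef
  have hJ : 0 < J := confFactor_pos x
  set b : Euc N := -((J / 2) • x) with hbdef
  have hball : ∀ R, 0 < R → IntegrableOn (invPull x G) (Metric.ball 0 R) := fun R hR =>
    (truncInt_eq_invPull hN x G hR).2.1 (hGi _ (inv_pos.2 hR))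
  -- With R ≥ 2 the condition |η| ≥ R/2 gives |x-y| = 1/|η| ≤ 1, where `hK` applies; replacing |η|
  -- by R/2 produces the power of 2⁻¹ in the constant.
  have hshell := tendsto_shell (s := s) (R₀ := 2)
    (K := K * 2⁻¹ ^ (-((N : ℝ) - 2 * s) - 1)) hN hs1 (by positivity) b
    (h := fun _ => invPull x G)
    (fun R hR => (hball (R + ‖b‖) (by linarith [norm_nonneg b])).mono_set
      (Metric.ball_subset_ball' (by rw [dist_zero_right])))
    (fun R hR => hball R (by linarith))
    (fun R η hR h1 _ => by
      have hp : 0 < ‖η‖ := by linarith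
      have h2 := hK (invMap x η) (by
        rw [norm_sub_invMap]
        exact inv_le_one_of_one_le₀ (by linarith))
      rw [norm_sub_invMap, Real.inv_rpow hp.le, div_inv_eq_mul] at h2
      have h3 : ((‖η‖ ^ 2)⁻¹) ^ N * (K * ‖η‖⁻¹ * ‖η‖ ^ ((N : ℝ) + 2 * s)) =
          K * ‖η‖ ^ (-((N : ℝ) - 2 * s) - 1) := by
        rw [show -((N : ℝ) - 2 * s) - 1 = (N : ℝ) + 2 * s - 1 - ((2 * N : ℕ) : ℝ) by
            push_cast; ring, Real.rpow_sub_natCast hp.ne', Real.rpow_sub_one hp.ne', pow_mul,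
          inv_pow]
        field_simp
      rw [invPull, abs_mul, abs_of_nonneg (by positivity)]
      refine (mul_le_mul_of_nonneg_left h2 (by positivity)).trans (h3.trans_le ?_)
      rw [mul_assoc, ← Real.mul_rpow (by norm_num) (by linarith)]
      refine mul_le_mul_of_nonneg_left ?_ hK0
      exact Real.rpow_le_rpow_of_nonpos (by linarith) (by linarith) (by linarith))
  have h0 := tendsto_truncInt_inv hG
  have h1 : Tendsto (fun R => ∫ η in Metric.ball b R, invPull x G η) atTop (𝓝 L) := by
    have h2 := hshell.add h0
    rw [zero_add] at h2
    refine h2.congr' ?_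
    filter_upwards [eventually_gt_atTop 0] with R hR
    rw [(truncInt_eq_invPull hN x G hR).1]
    ring
  -- This radius solves (R² + (J/2)²)ε² = J², as `preimage_invMap_chord` requires.
  have hR : Tendsto (fun ε : ℝ => Real.sqrt ((J * ε⁻¹) ^ 2 - (J / 2) ^ 2)) (𝓝[>] 0) atTop := by
    refine Real.tendsto_sqrt_atTop.comp (tendsto_atTop_add_const_right _ _ ?_)
    exact (tendsto_pow_atTop two_ne_zero).comp (tendsto_inv_nhdsGT_zero.const_mul_atTop hJ)
  refine (h1.comp hR).congr' ?_
  filter_upwards [self_mem_nhdsWithin, hR.eventually_gt_atTop 0] with ε hε hpos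
  have hε0 : (0 : ℝ) < ε := hε
  have hsq := Real.sq_sqrt (Real.sqrt_pos.1 hpos).le
  have h3 := (setIntegral_eq_invPull (x := x)
    (P := {y | ε < dist (stereoInv x) (stereoInv y)})
    (measurableSet_lt measurable_const
      (measurable_const.dist (continuous_stereoInv N).measurable))
    (by simp [hε0.le]) G).1
  rw [preimage_invMap_chord x hpos hε0 (by rw [hsq, ← hJdef]; field_simp; ring),
    setIntegral_congr_set (ball_sdiff_ae_eq hN _ _)] at h3
  exact h3.symm

theorem integrableOn_sphIntegrand {N : ℕ} {s : ℝ} (hs : 0 < s) {u : Sph N → ℝ}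
    (hu : Continuous u) (z : Sph N) {ε : ℝ} (hε : 0 < ε) :
    IntegrableOn (sphIntegrand s u z) {ζ | ε < dist z ζ} (sphVol N) := by
  obtain ⟨M, hM⟩ := isCompact_univ.exists_bound_of_continuousOn (f := u) hu.continuousOn
  have hm : Measurable (sphIntegrand s u z) := by
    refine (measurable_const.sub hu.measurable).div (Measurable.pow_const ?_ _)
    exact (continuous_const.sub continuous_subtype_val).norm.measurable
  refine Measure.integrableOn_of_bounded (M := 2 * M / ε ^ ((N : ℝ) + 2 * s))
    (measure_ne_top _ _) hm.aestronglyMeasurable ?_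
  filter_upwards [self_mem_ae_restrict
    (measurableSet_lt measurable_const (measurable_const.dist measurable_id))] with ζ hζ
  have hd : ε < ‖(z : Euc (N + 1)) - ζ‖ := by
    have h1 : ε < dist z ζ := hζ
    rwa [Subtype.dist_eq, dist_eq_norm] at h1
  have h2 := hM z (Set.mem_univ _)
  have h3 := hM ζ (Set.mem_univ _)
  rw [sphIntegrand, norm_div, Real.norm_of_nonneg (Real.rpow_nonneg (norm_nonneg _) _)]
  refine div_le_div₀ (by linarith [norm_nonneg (u z)]) ?_ (by positivity)
    (Real.rpow_le_rpow hε.le hd.le (by positivity))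
  linarith [norm_sub_le (u z) (u ζ)]

end ConformalSphere

theorem mainTheorem9 (N : ℕ) (s : ℝ) (hs0 : 0 < s) (hs1 : s < 1) (hsN : 2 * s < (N : ℝ))
    (u : ConformalSphere.Sph N → ℝ)
    (hu : ContMDiff (𝓡 N) 𝓘(ℝ, ℝ) ∞ u)
    (v : ConformalSphere.Euc N → ℝ) (hv : v = u ∘ ConformalSphere.stereoInv)
    (z : ConformalSphere.Sph N) (hz : z ≠ ConformalSphere.southPole N)
    (x : ConformalSphere.Euc N) (hx : x = ConformalSphere.stereo z) :
    ConformalSphere.PVExists (ConformalSphere.sphVol N) z (ConformalSphere.sphIntegrand s u z) ∧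
    ConformalSphere.PVExists volume x
      (ConformalSphere.eucIntegrand s (fun y => ConformalSphere.psi s y * v y) x) ∧
    ConformalSphere.confFracLap s u z =
      ConformalSphere.psi s x ^ (-(((N : ℝ) + 2 * s) / ((N : ℝ) - 2 * s))) *
        ConformalSphere.fracLap s (fun y => ConformalSphere.psi s y * v y) x := by
  open ConformalSphere in
  have hN : N ≠ 0 := by
    rintro rfl
    norm_num at hsN
    linarith
  have hzx : z = stereoInv x := by rw [hx, stereoInv_stereo hz]
  clear hx hz
  subst hv hzx
  have hJ := confFactor_pos x
  have hvs : ContDiff ℝ 2 (u ∘ stereoInv) := contDiff_infty.1 (contDiff_comp_stereoInv hu) 2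
  have hψs : ContDiff ℝ 2 (psi (N := N) s) := contDiff_infty.1 (contDiff_psi N s) 2
  set w : Euc N → ℝ := fun y => psi s y * (u ∘ stereoInv) y with hw
  have hws : ContDiff ℝ 2 w := hψs.mul hvs
  obtain ⟨M, hM⟩ := isCompact_univ.exists_bound_of_continuousOn (f := u) hu.continuous.continuousOn
  have hM' : ∀ ζ, |u ζ| ≤ M := fun ζ => hM ζ (Set.mem_univ ζ)
  have hwb : ∀ y, |w y| ≤ 2 ^ (((N : ℝ) - 2 * s) / 2) * M := fun y => by
    rw [hw, abs_mul, abs_of_pos (psi_pos s y)]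
    exact mul_le_mul (psi_le hsN y) (hM' _) (abs_nonneg _) (by positivity)
  have hψb : ∀ y : Euc N, |psi s y| ≤ 2 ^ (((N : ℝ) - 2 * s) / 2) := fun y => by
    rw [abs_of_pos (psi_pos s y)]
    exact psi_le hsN y
  have hPV := pvExists_eucIntegrand hN hs0 hs1 hws hwb x
  have hψi := (pvExists_eucIntegrand hN hs0 hs1 hψs hψb x).1
  have hψL := tendsto_truncInt_psi hs0 hs1 hsN x
  have hconst := cConst_mul_bubble hs0 hs1 hsN hJ
  set C := confFactor x ^ (((N : ℝ) - 2 * s) / 2) * (Real.pi ^ ((N : ℝ) / 2) *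
    Real.Gamma (1 - s) / (s * Real.Gamma ((N : ℝ) / 2 - s)) * ((confFactor x / 2) ^ 2) ^ s)
  obtain ⟨hwi, L, hwL⟩ := id hPV
  -- The numerator of G is ψ_s(y)(v(x)-v(y)), first order at x, which is the bound that
  -- `tendsto_chordal_trunc` asks for.
  set G : Euc N → ℝ := fun y => eucIntegrand s w x y - u (stereoInv x) * eucIntegrand s (psi s) x y
    with hG
  have hGi : ∀ δ, 0 < δ → IntegrableOn G {y | δ < dist x y} := fun δ hδ =>
    (hwi δ hδ).sub ((hψi δ hδ).const_mul _)
  have hGL : Tendsto (truncInt volume x G) (𝓝[>] 0) (𝓝 (L - u (stereoInv x) * C)) := by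
    refine (hwL.sub (hψL.const_mul (u (stereoInv x)))).congr' ?_
    filter_upwards [self_mem_nhdsWithin] with δ hδ
    rw [truncInt, truncInt, truncInt, hG, integral_sub (hwi δ hδ) ((hψi δ hδ).const_mul _),
      integral_const_mul]
  obtain ⟨Lip, hLip0, hLip⟩ := exists_lipschitz_bound hvs x
  have hGb : ∀ y, ‖x - y‖ ≤ 1 → |G y| ≤
      (2 ^ (((N : ℝ) - 2 * s) / 2) * Lip) * ‖x - y‖ / ‖x - y‖ ^ ((N : ℝ) + 2 * s) := by
    intro y hy
    have h1 : G y = (psi s y * ((u ∘ stereoInv) x - (u ∘ stereoInv) y)) /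
        ‖x - y‖ ^ ((N : ℝ) + 2 * s) := by
      simp only [hG, hw, eucIntegrand, Function.comp]
      ring
    have h2 := hLip (y - x) (by rwa [norm_sub_rev])
    rw [add_sub_cancel, abs_sub_comm, norm_sub_rev] at h2
    rw [h1, abs_div, abs_of_nonneg (Real.rpow_nonneg (norm_nonneg _) _), abs_mul, mul_assoc]
    refine div_le_div_of_nonneg_right ?_ (Real.rpow_nonneg (norm_nonneg _) _)
    exact mul_le_mul (hψb y) h2 (abs_nonneg _) (by positivity)
  have hch := tendsto_chordal_trunc hN hs1 hsN x (by positivity) hGb hGi hGL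
  have hS : Tendsto (truncInt (sphVol N) (stereoInv x) (sphIntegrand s u (stereoInv x))) (𝓝[>] 0)
      (𝓝 (confFactor x ^ (-(((N : ℝ) + 2 * s) / 2)) * (L - u (stereoInv x) * C))) := by
    refine (hch.const_mul _).congr fun ε => ?_
    rw [truncInt_sphVol hN, ← integral_const_mul]
    simp_rw [confFactor_pow_mul_sphIntegrand]
    rfl
  refine ⟨⟨fun ε hε => integrableOn_sphIntegrand hs0 hu.continuous _ hε, _, hS⟩, hPV, ?_⟩
  have h1 : pv (sphVol N) (stereoInv x) (sphIntegrand s u (stereoInv x)) = _ := hS.limUnder_eq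
  have h2 : pv volume x (eucIntegrand s w x) = L := hwL.limUnder_eq
  have h3 : psi s x ^ (-(((N : ℝ) + 2 * s) / ((N : ℝ) - 2 * s))) =
      confFactor x ^ (-(((N : ℝ) + 2 * s) / 2)) := by
    have : (N : ℝ) - 2 * s ≠ 0 := by linarith
    rw [psi_eq_confFactor, ← Real.rpow_mul hJ.le]
    congr 1
    field_simp
  have h4 : confFactor x ^ (-(((N : ℝ) + 2 * s) / 2)) * confFactor x ^ (((N : ℝ) + 2 * s) / 2) = 1
      := by rw [← Real.rpow_add hJ, neg_add_cancel, Real.rpow_zero]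
  rw [confFracLap, fracLap, h1, h2, h3]
  -- The bubble equation turns the -u(z)C term into -A_{N,s}u(z), which cancels the zero-order term.
  linear_combination (-(confFactor x ^ (-(((N : ℝ) + 2 * s) / 2)) * u (stereoInv x))) * hconst -
    AConst N s * u (stereoInv x) * h4
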